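/- Let $W(Y)=Y-e^{Y}$ on the complex $Y$-plane with its flat metric, with critical points $Y_k=2\pi i k$, $k\in\mathbb Z$. For $|\zeta|=1$ let the left Lefschetz thimble $L_k(\zeta)$ be the set of points $p\in\mathbb C$ whose backward trajectory under the gradient flow of $\mathrm{Re}(\zeta^{-1}W)$ (that is, the solution of $dY/dx=\zeta\,\overline{W'(Y)}$, $Y(0)=p$) exists for all $x\le 0$ and tends to $Y_k$ as $x\to-\infty$. Since $W''(Y_k)=-1$, the unit tangent vectors of $L_k(\zeta)$ at $Y_k$ are the two square roots of $-\zeta$. Orient the thimbles with $\mathrm{Re}\,\zeta\ne 0$ by choosing such a tangent vector $o(\zeta)$ independent of $k$ and continuous in $\zeta$ on each of the half-circles $\mathrm{Re}\,\zeta>0$ and $\mathrm{Re}\,\zeta<0$; the choice is otherwise arbitrary. At a transversal intersection point of two oriented thimbles, the orientation of the point is the sign of the basis (positive tangent of the first thimble, positive tangent of the second thimble) with respect to the standard orientation of $\mathbb C$. Let $\theta,\theta'\in(0,\frac{\pi}{2})$ and, for $k,l\in\mathbb Z$, put $$I_{k,l}(\theta,\theta')=L_k(-e^{-i\theta'})\cap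 L_l(-e^{i\theta}),\qquad J_{k,l}(\theta,\theta')=L_k(e^{-i\theta'})\cap L_l(e^{i\theta}).$$ The thimbles occurring in a non-empty intersection are $C^1$ embedded curves (regular embedded images of $\mathbb R$), they cross transversally, and: 1. $I_{k,l}(\theta,\theta')$ consists of a single point, with positive orientation, if $k\le l$, and is empty otherwise. 2. $J_{k,l}(\theta,\theta')$ consists of a single point, with negative orientation if $k=l+1$ and with positive orientation if $k=l$, and is empty otherwise. -/

import Mathlib

open Set Filter Topology

noncomputable section

namespace Thimble

/-- The superpotential `W = Y - e ^ Y` on the complex `Y`-plane. -/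
def W (Y : ℂ) : ℂ := Y - Complex.exp Y

/-- The critical points `Y_k = 2 π i k` of `W`. -/
def crit (k : ℤ) : ℂ := 2 * (Real.pi : ℂ) * Complex.I * (k : ℂ)

/-- The vector field whose flow is the gradient flow of the real function `Re (ζ⁻¹ W)` on the
`Y`-plane with its flat metric. For `‖ζ‖ = 1` it is `ζ` times the complex conjugate of `W'`. -/
def gradField (ζ : ℂ) : ℂ → ℂ :=
  gradient (fun Y : ℂ => (ζ⁻¹ * W Y).re)

/-- The left Lefschetz thimble `L_k(ζ)`: the points whose backward trajectory under the gradient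
flow of `Re (ζ⁻¹ W)` exists for all times `x ≤ 0` and converges to `Y_k` as `x → -∞`. Only
backward trajectories are asked to exist, since forward ones may blow up in finite time. -/
def L (k : ℤ) (ζ : ℂ) : Set ℂ :=
  {p | ∃ γ : ℝ → ℂ, IsIntegralCurveOn γ (fun _ => gradField ζ) (Iic 0) ∧
    γ 0 = p ∧ Tendsto γ atBot (𝓝 (crit k))}

/-- A coherent choice of orientations of all the thimbles `L_k(ζ)` with `‖ζ‖ = 1`, `Re ζ ≠ 0`:
a tangent direction `o ζ` of `L_k(ζ)` at `Y_k` that does not depend on `k` (so it is invariant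
under the deck transformations `Y ↦ Y + 2 π i`) and is continuous in the phase `ζ` on each of the
half-circles `Re ζ > 0` and `Re ζ < 0`.  As `W = W(Y_k) - (Y - Y_k)² / 2 + ⋯`, the two unit
tangent vectors of `L_k(ζ)` at `Y_k` are the square roots of `-ζ`. -/
def IsOrientation (o : ℂ → ℂ) : Prop :=
  ContinuousOn o {ζ | ‖ζ‖ = 1 ∧ ζ.re ≠ 0} ∧ ∀ ζ : ℂ, ‖ζ‖ = 1 → ζ.re ≠ 0 → o ζ ^ 2 = -ζ

/-- `γ` is a regular parametrization of the whole embedded curve `C ⊆ ℂ` which runs through the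
point `q` in the direction `v`. It orients `C` by its velocity. -/
structure IsOrientedParam (C : Set ℂ) (q v : ℂ) (γ : ℝ → ℂ) : Prop where
  contDiff : ContDiff ℝ 1 γ
  isEmbedding : IsEmbedding γ
  deriv_ne_zero : ∀ t, deriv γ t ≠ 0
  range_eq : range γ = C
  map_zero : γ 0 = q
  deriv_zero : ∃ c : ℝ, 0 < c ∧ deriv γ 0 = c • v

/-- The thimbles `L_k(ζ)` and `L_l(ζ')`, oriented by `o`, are embedded curves whose only common
point is `p`, they cross transversally there, and the orientation (local intersection number) of
`p` is `ε`: the sign of the determinant of the pair (positive tangent vector of `L_k(ζ)`,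
positive tangent vector of `L_l(ζ')`) at `p`, in this order, for the standard orientation
of `ℂ`. -/
def MeetsOnceAt (o : ℂ → ℂ) (k : ℤ) (ζ : ℂ) (l : ℤ) (ζ' : ℂ) (p : ℂ) (ε : SignType) : Prop :=
  L k ζ ∩ L l ζ' = {p} ∧
  ∃ (γ δ : ℝ → ℂ) (s t : ℝ),
    IsOrientedParam (L k ζ) (crit k) (o ζ) γ ∧ IsOrientedParam (L l ζ') (crit l) (o ζ') δ ∧
    γ s = p ∧ δ t = p ∧
    (deriv γ s).re * (deriv δ t).im - (deriv γ s).im * (deriv δ t).re ≠ 0 ∧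
    SignType.sign ((deriv γ s).re * (deriv δ t).im - (deriv γ s).im * (deriv δ t).re) = ε

end Thimble

end

/-!
Let `W₀ = W + 1`. Along a gradient trajectory of `Re (ζ⁻¹ W)` issuing from `0`, the function
`ζ⁻¹ W₀` is real and increases from `0`, so `W₀` maps `L_0(ζ)` into the ray `ζ ℝ_{≥0}`. The
function `W₀` has two sheets adjacent to `0` over the left half-plane, namely `Re Y < 0` and a
domain inside `Re Y > 0`, `|Im Y| < π / 2`; over the right half-plane it has the sheets
`0 < Im Y < 2 π` and `-2 π < Im Y < 0`. On each of them `W₀` is a bijection onto the half-plane,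
so `L_0(ζ)` consists of `0` and the two lifts of the open ray. Parametrising it by the signed
square root `s` of `ζ⁻¹ W₀` gives an embedding, smooth at `0` by the Morse lemma, and
`L_k(ζ) = L_0(ζ) + Y_k`.

A common point of `L_k(ζ)` and `L_l(ζ')` lies over an intersection of the rays `Y_k + ζ ℝ_{≥0}`
and `Y_l + ζ' ℝ_{≥0}`. There is at most one, its parameters `s ^ 2` and `t ^ 2` being explicit. If
`k = l`, it is the critical point. Otherwise the sheets decide which of the four choices of signs
of `s` and `t` yields a common point, and the local intersection number there is the sign of `s t`.
-/

namespace Thimble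

open scoped Real ComplexConjugate

/-- The superpotential, normalised to vanish at the critical point `0`. -/
noncomputable def W₀ (Y : ℂ) : ℂ := W Y + 1

lemma W₀_eq (Y : ℂ) : W₀ Y = 1 + Y - Complex.exp Y := by rw [W₀, W]; ring

lemma W₀_re (Y : ℂ) : (W₀ Y).re = 1 + Y.re - Real.exp Y.re * Real.cos Y.im := by
  simp [W₀_eq, Complex.exp_re]

@[simp] lemma W₀_zero : W₀ 0 = 0 := by simp [W₀_eq]

lemma hasDerivAt_W₀ (Y : ℂ) : HasDerivAt W₀ (1 - Complex.exp Y) Y :=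
  ((hasDerivAt_id Y).sub (Complex.hasDerivAt_exp Y)).add_const 1

lemma deriv_W₀ : deriv W₀ = fun Y => 1 - Complex.exp Y := funext fun Y => (hasDerivAt_W₀ Y).deriv

lemma analyticAt_W₀ (Y : ℂ) : AnalyticAt ℂ W₀ Y :=
  (show Differentiable ℂ W₀ from fun Y => (hasDerivAt_W₀ Y).differentiableAt).analyticAt Y

lemma continuous_W₀ : Continuous W₀ :=
  continuous_iff_continuousAt.2 fun Y => (hasDerivAt_W₀ Y).continuousAt

@[simp] lemma crit_re (k : ℤ) : (crit k).re = 0 := by simp [crit]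

@[simp] lemma crit_im (k : ℤ) : (crit k).im = 2 * π * k := by simp [crit]

@[simp] lemma crit_zero : crit 0 = 0 := by simp [crit]

lemma crit_add (j k : ℤ) : crit (j + k) = crit j + crit k := by
  simp only [crit, Int.cast_add]; ring

@[simp] lemma exp_crit (k : ℤ) : Complex.exp (crit k) = 1 := by
  rw [← Complex.exp_int_mul_two_pi_mul_I k, crit, mul_comm]

@[simp] lemma exp_add_crit (Y : ℂ) (k : ℤ) : Complex.exp (Y + crit k) = Complex.exp Y := by
  rw [Complex.exp_add, exp_crit, mul_one]

@[simp] lemma W₀_add_crit (Y : ℂ) (k : ℤ) : W₀ (Y + crit k) = W₀ Y + crit k := by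
  simp only [W₀_eq, exp_add_crit]; ring

lemma gradField_apply (ζ Y : ℂ) : gradField ζ Y = conj (ζ⁻¹ * (1 - Complex.exp Y)) := by
  apply HasGradientAt.gradient
  rw [hasGradientAt_iff_hasFDerivAt]
  have hW : HasDerivAt W (1 - Complex.exp Y) Y := (hasDerivAt_id Y).sub (Complex.hasDerivAt_exp Y)
  have h := Complex.reCLM.hasFDerivAt.comp Y
    ((hW.const_mul ζ⁻¹).hasFDerivAt.restrictScalars ℝ)
  refine h.congr_fderiv ?_
  ext
  simp [Complex.inner]

lemma add_crit_mem_L {ζ p : ℂ} {k : ℤ} (hp : p ∈ L k ζ) (j : ℤ) : p + crit j ∈ L (k + j) ζ := by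
  obtain ⟨Γ, hΓ, rfl, hlim⟩ := hp
  refine ⟨fun x => Γ x + crit j, fun x hx => ?_, rfl, crit_add k j ▸ hlim.add_const _⟩
  simpa only [gradField_apply, exp_add_crit] using (hΓ x hx).add_const (crit j)

lemma L_eq_image (k : ℤ) (ζ : ℂ) : L k ζ = (· + crit k) '' L 0 ζ := by
  ext p
  constructor
  · intro hp
    refine ⟨p + crit (-k), by simpa using add_crit_mem_L hp (-k), ?_⟩
    simp [add_assoc, ← crit_add]
  · rintro ⟨q, hq, rfl⟩
    simpa using add_crit_mem_L hq k

lemma norm_le_of_re_nonpos {Y : ℂ} (hY : Y.re ≤ 0) : ‖Y‖ ≤ ‖W₀ Y‖ + 2 := by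
  have hexp : ‖Complex.exp Y‖ ≤ 1 := by rwa [Complex.norm_exp, Real.exp_le_one_iff]
  calc ‖Y‖ = ‖W₀ Y - 1 + Complex.exp Y‖ := by rw [W₀_eq]; ring_nf
    _ ≤ ‖W₀ Y‖ + ‖(1 : ℂ)‖ + ‖Complex.exp Y‖ :=
        (norm_add_le _ _).trans (by gcongr; exact norm_sub_le _ _)
    _ ≤ ‖W₀ Y‖ + 2 := by rw [norm_one]; linarith

lemma norm_le_of_abs_im_le {Y : ℂ} {M : ℝ} (hY : |Y.im| ≤ M) : ‖Y‖ ≤ ‖W₀ Y‖ + 2 * M + 2 := by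
  have hM : 0 ≤ M := (abs_nonneg _).trans hY
  rcases le_total Y.re 0 with hre | hre
  · linarith [norm_le_of_re_nonpos hre]
  have hexp : Real.exp Y.re ≤ ‖W₀ Y‖ + 1 + ‖Y‖ :=
    calc Real.exp Y.re = ‖1 + Y - W₀ Y‖ := by rw [← Complex.norm_exp, W₀_eq]; ring_nf
      _ ≤ ‖(1 : ℂ)‖ + ‖Y‖ + ‖W₀ Y‖ :=
          (norm_sub_le _ _).trans (by gcongr; exact norm_add_le _ _)
      _ = ‖W₀ Y‖ + 1 + ‖Y‖ := by rw [norm_one]; ring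
  have hnorm := Complex.norm_le_abs_re_add_abs_im Y
  rw [abs_of_nonneg hre] at hnorm
  -- The exponential absorbs the real part because `2 x ≤ 2 + x ^ 2 / 2`.
  nlinarith [Real.quadratic_le_exp_of_nonneg hre, sq_nonneg (Y.re - 2)]

/-! ### Sheets of `W₀` over half-planes -/

lemma injOn_of_re_mul_deriv_pos {f f' : ℂ → ℂ} {s : Set ℂ} (hs : Convex ℝ s)
    (hf : ∀ z ∈ s, HasDerivAt f (f' z) z) (c : ℂ) (hpos : ∀ z ∈ s, 0 < (c * f' z).re) :
    InjOn f s := by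
  intro a ha b hb hab
  by_contra hne
  have hmem : ∀ t ∈ Icc (0 : ℝ) 1, a + t * (b - a) ∈ s := fun t ht => by
    simpa using hs.add_smul_sub_mem ha hb ht
  have hderiv : ∀ t ∈ Icc (0 : ℝ) 1,
      HasDerivAt (fun t : ℝ => (c * conj (b - a) * f (a + t * (b - a))).re)
        (c * conj (b - a) * (f' (a + t * (b - a)) * (b - a))).re t := by
    intro t ht
    have hline : HasDerivAt (fun t : ℝ => a + (t : ℂ) * (b - a)) (b - a) t := by
      simpa using ((Complex.ofRealCLM.hasDerivAt (x := t)).mul_const (b - a)).const_add a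
    exact Complex.reCLM.hasFDerivAt.comp_hasDerivAt t
      (((hf _ (hmem t ht)).comp t hline).const_mul (c * conj (b - a)))
  obtain ⟨t, ht, hzero⟩ := exists_hasDerivAt_eq_zero (zero_lt_one' ℝ)
    (fun t ht => (hderiv t ht).continuousAt.continuousWithinAt) (by simp [hab])
    (fun t ht => hderiv t (Ioo_subset_Icc_self ht))
  have hfactor : c * conj (b - a) * (f' (a + t * (b - a)) * (b - a))
      = c * f' (a + t * (b - a)) * (Complex.normSq (b - a) : ℂ) := by
    rw [← Complex.mul_conj]; ring
  rw [hfactor, Complex.re_mul_ofReal] at hzero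
  exact (mul_pos (hpos _ (hmem t (Ioo_subset_Icc_self ht)))
    (Complex.normSq_pos.2 (sub_ne_zero.2 (Ne.symm hne)))).ne' hzero

lemma surjOn_of_isBounded_preimage {X F : Type*} [PseudoMetricSpace X] [ProperSpace X]
    [MetricSpace F] {f : X → F} {U : Set X} {T : Set F} (hf : Continuous f) (hU : IsOpen U)
    (hopen : ∀ z ∈ U, 𝓝 (f z) ≤ map f (𝓝 z)) (hT : IsPreconnected T)
    (hne : (U ∩ f ⁻¹' T).Nonempty)
    (hbdd : ∀ B, Bornology.IsBounded B → Bornology.IsBounded (U ∩ f ⁻¹' B))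
    (hclosure : ∀ z ∈ closure U, f z ∈ T → z ∈ U) : SurjOn f U T := by
  refine hT.subset_of_closure_inter_subset ?_ ?_ ?_
  · rw [isOpen_iff_mem_nhds]
    rintro _ ⟨z, hz, rfl⟩
    exact hopen z hz (image_mem_map (hU.mem_nhds hz))
  · obtain ⟨z, hzU, hzT⟩ := hne
    exact ⟨f z, hzT, z, hzU, rfl⟩
  · rintro w ⟨hw, hwT⟩
    obtain ⟨u, hu, hlim⟩ := mem_closure_iff_seq_limit.1 hw
    choose y hyU hy using hu
    obtain ⟨z, hz, φ, hφ, hzlim⟩ := tendsto_subseq_of_bounded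
      (hbdd _ (Metric.isBounded_range_of_tendsto u hlim)) fun n => ⟨hyU n, n, (hy n).symm⟩
    have hfz : f z = w := tendsto_nhds_unique ((hf.tendsto z).comp hzlim) <| by
      simpa only [Function.comp_def, hy] using hlim.comp hφ.tendsto_atTop
    exact ⟨z, hclosure z (closure_mono inter_subset_left hz) (hfz ▸ hwT), hfz⟩

/-- The open half-plane centred at the direction `-μ ^ 2`. As `W₀ Y = -Y ^ 2 / 2 + ⋯`, it is the
half-plane of those values which `W₀` takes near the critical point `0` in the directions close
to `μ` and to `-μ`. The left half-plane is `halfPlane 1` and the right one is `halfPlane I`. -/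
def halfPlane (μ : ℂ) : Set ℂ := {w | 0 < (-conj μ ^ 2 * w).re}

@[simp] lemma halfPlane_neg (μ : ℂ) : halfPlane (-μ) = halfPlane μ := by simp [halfPlane]

@[simp] lemma mem_halfPlane_one {w : ℂ} : w ∈ halfPlane 1 ↔ w.re < 0 := by simp [halfPlane]

@[simp] lemma mem_halfPlane_I {w : ℂ} : w ∈ halfPlane Complex.I ↔ 0 < w.re := by
  simp [halfPlane]

lemma isOpen_halfPlane (μ : ℂ) : IsOpen (halfPlane μ) :=
  isOpen_lt continuous_const (by fun_prop)

lemma convex_halfPlane (μ : ℂ) : Convex ℝ (halfPlane μ) :=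
  (convex_Ioi (0 : ℝ)).linear_preimage
    (Complex.reLm ∘ₗ LinearMap.mulLeft ℝ (-conj μ ^ 2))

lemma mul_ofReal_mem_halfPlane {μ w : ℂ} (hw : w ∈ halfPlane μ) {r : ℝ} (hr : 0 < r) :
    w * r ∈ halfPlane μ := by
  have hmul := mul_pos (show 0 < (-conj μ ^ 2 * w).re from hw) hr
  rwa [← Complex.re_mul_ofReal, mul_assoc] at hmul

/-- `U` is a sheet of `W₀` over `halfPlane μ`: a domain without critical points which `W₀` maps
bijectively onto this half-plane, and which is relatively closed in its preimage. -/
structure IsSheet (μ : ℂ) (U : Set ℂ) : Prop where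
  isOpen : IsOpen U
  exp_ne_one : ∀ Y ∈ U, Complex.exp Y ≠ 1
  bijOn : BijOn W₀ U (halfPlane μ)
  mem_of_mem_closure : ∀ Y ∈ closure U, W₀ Y ∈ halfPlane μ → Y ∈ U

lemma isSheet_inter_preimage {μ : ℂ} {D : Set ℂ} {C : ℝ} (hD : IsOpen D)
    (hexp : ∀ Y ∈ D, Complex.exp Y ≠ 1) (hinj : InjOn W₀ (D ∩ W₀ ⁻¹' halfPlane μ))
    (hne : (D ∩ W₀ ⁻¹' halfPlane μ).Nonempty) (hnorm : ∀ Y ∈ D, ‖Y‖ ≤ ‖W₀ Y‖ + C)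
    (hclosure : ∀ Y ∈ closure D, W₀ Y ∈ halfPlane μ → Y ∈ D) :
    IsSheet μ (D ∩ W₀ ⁻¹' halfPlane μ) := by
  have hopen : IsOpen (D ∩ W₀ ⁻¹' halfPlane μ) :=
    hD.inter ((isOpen_halfPlane μ).preimage continuous_W₀)
  have hclosure' : ∀ Y ∈ closure (D ∩ W₀ ⁻¹' halfPlane μ), W₀ Y ∈ halfPlane μ →
      Y ∈ D ∩ W₀ ⁻¹' halfPlane μ :=
    fun Y hY hW => ⟨hclosure Y (closure_mono inter_subset_left hY) hW, hW⟩
  refine ⟨hopen, fun Y hY => hexp Y hY.1, ⟨fun _ hY => hY.2, hinj, ?_⟩, hclosure'⟩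
  refine surjOn_of_isBounded_preimage continuous_W₀ hopen (fun Y hY => ?_)
    (convex_halfPlane μ).isPreconnected (hne.mono fun Y hY => ⟨hY, hY.2⟩) (fun B hB => ?_)
    hclosure'
  · refine ((analyticAt_W₀ Y).hasStrictDerivAt.map_nhds_eq ?_).ge
    rw [deriv_W₀]
    exact sub_ne_zero.2 (hexp Y hY.1).symm
  · obtain ⟨R, hR⟩ := isBounded_iff_forall_norm_le.1 hB
    exact isBounded_iff_forall_norm_le.2
      ⟨R + C, fun Y hY => (hnorm Y hY.1.1).trans (by gcongr; exact hR _ hY.2)⟩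

/-- The sheet over the left half-plane on the left of the critical points. -/
def leftSheet : Set ℂ := {Y | Y.re < 0} ∩ W₀ ⁻¹' halfPlane 1

/-- The sheet over the left half-plane on the right of the critical point `0`. -/
def rightSheet : Set ℂ := ({Y | 0 < Y.re} ∩ {Y | |Y.im| < π / 2}) ∩ W₀ ⁻¹' halfPlane 1

/-- The sheet over the right half-plane between the critical points `Y_m` and `Y_{m+1}`. -/
def stripSheet (m : ℤ) : Set ℂ :=
  {Y | Y.im ∈ Ioo (2 * π * m) (2 * π * (m + 1))} ∩ W₀ ⁻¹' halfPlane Complex.I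

lemma re_ne_zero_of_W₀_re_neg {Y : ℂ} (hY : (W₀ Y).re < 0) : Y.re ≠ 0 := by
  intro hre
  rw [W₀_re, hre, Real.exp_zero] at hY
  linarith [Real.cos_le_one Y.im]

lemma abs_im_ne_of_W₀_re_neg {Y : ℂ} (hre : 0 ≤ Y.re) (hY : (W₀ Y).re < 0) :
    |Y.im| ≠ π / 2 := by
  intro him
  rw [W₀_re, ← Real.cos_abs, him, Real.cos_pi_div_two] at hY
  linarith

lemma im_ne_of_W₀_re_pos {Y : ℂ} (hY : 0 < (W₀ Y).re) (m : ℤ) : Y.im ≠ 2 * π * m := by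
  intro him
  rw [W₀_re, him, mul_comm (2 * π), Real.cos_int_mul_two_pi] at hY
  linarith [Real.add_one_le_exp Y.re]

lemma exp_ne_one_of_re_ne_zero {Y : ℂ} (hY : Y.re ≠ 0) : Complex.exp Y ≠ 1 := fun h => hY <| by
  simpa [Complex.norm_exp] using congrArg norm h

lemma isSheet_leftSheet : IsSheet 1 leftSheet := by
  refine isSheet_inter_preimage (isOpen_lt Complex.continuous_re continuous_const)
    (fun Y hY => exp_ne_one_of_re_ne_zero (ne_of_lt hY)) ?_ ⟨-5, by simp, ?_⟩
    (fun Y hY => norm_le_of_re_nonpos (le_of_lt hY)) fun Y hY hW => ?_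
  · refine (injOn_of_re_mul_deriv_pos (convex_halfSpace_re_lt 0) (fun Y _ => hasDerivAt_W₀ Y) 1
      fun Y hY => ?_).mono inter_subset_left
    have hexp : ‖Complex.exp Y‖ < 1 := by rwa [Complex.norm_exp, Real.exp_lt_one_iff]
    simpa using (Complex.re_le_norm _).trans_lt hexp
  · have hexp := Real.exp_pos (-5)
    rw [mem_preimage, mem_halfPlane_one, W₀_re, Complex.neg_re, Complex.neg_im, Complex.re_ofNat,
      Complex.im_ofNat, neg_zero, Real.cos_zero]
    linarith
  · exact lt_of_le_of_ne (closure_lt_subset_le Complex.continuous_re continuous_const hY)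
      (re_ne_zero_of_W₀_re_neg (mem_halfPlane_one.1 hW))

lemma injOn_rightSheet : InjOn W₀ rightSheet := by
  have hlog : ∀ Y ∈ rightSheet, Complex.log (Complex.exp Y) = Y := fun Y hY => by
    have him : -(π / 2) < Y.im ∧ Y.im < π / 2 := abs_lt.1 hY.1.2
    exact Complex.log_exp (by linarith [Real.pi_pos]) (by linarith [Real.pi_pos])
  have hexp : MapsTo Complex.exp rightSheet {z | 1 < z.re} := fun Y hY => by
    have hre : 0 < Y.re := hY.1.1
    have hW := mem_halfPlane_one.1 hY.2
    rw [W₀_re] at hW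
    rw [mem_ofPred_eq, Complex.exp_re]
    linarith
  have hinj : InjOn (fun z => Complex.log z - z) {z : ℂ | 1 < z.re} := by
    refine injOn_of_re_mul_deriv_pos (f' := fun z => z⁻¹ - 1) (convex_halfSpace_re_gt 1)
      (fun z hz => (Complex.hasDerivAt_log (Or.inl (zero_lt_one.trans hz))).sub
        (hasDerivAt_id z)) (-1) fun z hz => ?_
    have hz1 : 1 < ‖z‖ := lt_of_lt_of_le hz (Complex.re_le_norm _)
    have hinv : z⁻¹.re < 1 :=
      (Complex.re_le_norm _).trans_lt (norm_inv z ▸ inv_lt_one_of_one_lt₀ hz1)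
    simpa using hinv
  intro a ha b hb hab
  rw [← hlog a ha, ← hlog b hb]
  congr 1
  refine hinj (hexp ha) (hexp hb) ?_
  simpa only [hlog a ha, hlog b hb, W₀, W, add_left_inj] using hab

lemma isSheet_rightSheet : IsSheet 1 rightSheet := by
  have him : Continuous fun Y : ℂ => |Y.im| := by fun_prop
  refine isSheet_inter_preimage ((isOpen_lt continuous_const Complex.continuous_re).inter
    (isOpen_lt him continuous_const)) (fun Y hY => exp_ne_one_of_re_ne_zero (ne_of_gt hY.1))
    injOn_rightSheet ⟨2, ⟨by simp, by simp [Real.pi_pos]⟩, ?_⟩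
    (fun Y hY => (norm_le_of_abs_im_le (le_of_lt hY.2)).trans_eq (add_assoc _ _ _))
    fun Y hY hW => ?_
  · have hexp := Real.quadratic_le_exp_of_nonneg (zero_le_two (α := ℝ))
    rw [mem_preimage, mem_halfPlane_one, W₀_re, Complex.re_ofNat, Complex.im_ofNat, Real.cos_zero]
    linarith
  · have hre : 0 ≤ Y.re := closure_lt_subset_le continuous_const Complex.continuous_re
      (closure_mono inter_subset_left hY)
    have hW := mem_halfPlane_one.1 hW
    exact ⟨hre.lt_of_ne' (re_ne_zero_of_W₀_re_neg hW), lt_of_le_of_ne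
      (closure_lt_subset_le him continuous_const (closure_mono inter_subset_right hY))
      (abs_im_ne_of_W₀_re_neg hre hW)⟩

lemma sign_im_add_exp {u : ℂ} (hu : |u.im| < π) :
    SignType.sign (u + Complex.exp u).im = SignType.sign u.im := by
  have hexp := Real.exp_pos u.re
  obtain ⟨hlt, hgt⟩ := abs_lt.1 hu
  rw [Complex.add_im, Complex.exp_im]
  rcases lt_trichotomy u.im 0 with h | h | h
  · have hsin := Real.sin_neg_of_neg_of_neg_pi_lt h hlt
    rw [sign_neg h, sign_neg (add_neg h (mul_neg_of_pos_of_neg hexp hsin))]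
  · simp [h]
  · have hsin := Real.sin_pos_of_pos_of_lt_pi h hgt
    rw [sign_pos h, sign_pos (add_pos h (mul_pos hexp hsin))]

lemma injOn_add_exp : InjOn (fun u => u + Complex.exp u) {u | |u.im| < π} := by
  have hderiv : ∀ u, HasDerivAt (fun u => u + Complex.exp u) (1 + Complex.exp u) u :=
    fun u => (hasDerivAt_id u).add (Complex.hasDerivAt_exp u)
  have hupper : InjOn (fun u => u + Complex.exp u) {u | 0 < u.im ∧ u.im < π} := by
    refine injOn_of_re_mul_deriv_pos ((convex_halfSpace_im_gt 0).inter (convex_halfSpace_im_lt π))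
      (fun u _ => hderiv u) (-Complex.I) fun u hu => ?_
    simpa [Complex.exp_im] using mul_pos (Real.exp_pos u.re) (Real.sin_pos_of_mem_Ioo hu)
  have hlower : InjOn (fun u => u + Complex.exp u) {u | -π < u.im ∧ u.im < 0} := by
    refine injOn_of_re_mul_deriv_pos ((convex_halfSpace_im_gt (-π)).inter
      (convex_halfSpace_im_lt 0)) (fun u _ => hderiv u) Complex.I fun u hu => ?_
    simpa [Complex.exp_im] using mul_neg_of_pos_of_neg (Real.exp_pos u.re)
      (Real.sin_neg_of_neg_of_neg_pi_lt hu.2 hu.1)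
  have hreal : InjOn (fun u => u + Complex.exp u) {u | u.im = 0} := by
    refine injOn_of_re_mul_deriv_pos ((convex_singleton (0 : ℝ)).linear_preimage Complex.imLm)
      (fun u _ => hderiv u) 1 fun u (hu : u.im = 0) => ?_
    simpa [Complex.exp_re, hu] using add_pos one_pos (Real.exp_pos u.re)
  intro u hu v hv huv
  have hsign : SignType.sign u.im = SignType.sign v.im := by
    rw [← sign_im_add_exp hu, ← sign_im_add_exp hv]
    exact congrArg _ (congrArg _ huv)
  obtain ⟨hult, hugt⟩ : -π < u.im ∧ u.im < π := abs_lt.1 hu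
  obtain ⟨hvlt, hvgt⟩ : -π < v.im ∧ v.im < π := abs_lt.1 hv
  rcases lt_trichotomy u.im 0 with h | h | h
  · exact hlower ⟨hult, h⟩ ⟨hvlt, sign_eq_neg_one_iff.1 (hsign ▸ sign_neg h)⟩ huv
  · exact hreal h (sign_eq_zero_iff.1 (hsign ▸ sign_eq_zero_iff.2 h)) huv
  · exact hupper ⟨h, hugt⟩ ⟨sign_eq_one_iff.1 (hsign ▸ sign_pos h), hvgt⟩ huv

lemma injOn_stripSheet (m : ℤ) : InjOn W₀ (stripSheet m) := by
  -- The substitution `Y = u + Y_m + π i` turns `W₀ Y` into `u + e ^ u` up to a constant.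
  have hW : ∀ Y, W₀ Y - (1 + crit m + π * Complex.I) =
      (Y - (crit m + π * Complex.I)) + Complex.exp (Y - (crit m + π * Complex.I)) := fun Y => by
    rw [Complex.exp_sub, Complex.exp_add, exp_crit, Complex.exp_pi_mul_I, W₀_eq]
    ring
  have him : MapsTo (· - (crit m + π * Complex.I)) (stripSheet m) {u | |u.im| < π} :=
    fun Y hY => by
      obtain ⟨hlt, hgt⟩ := hY.1
      simp only [mem_ofPred_eq, Complex.sub_im, Complex.add_im, crit_im,
        Complex.im_ofReal_mul, Complex.I_im, mul_one, abs_lt]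
      constructor <;> linarith
  intro a ha b hb hab
  exact sub_left_injective (injOn_add_exp (him ha) (him hb) (by simp only [← hW, hab]))

lemma isSheet_stripSheet (m : ℤ) : IsSheet Complex.I (stripSheet m) := by
  have hpi := Real.pi_pos
  refine isSheet_inter_preimage (C := 2 * (|2 * π * m| + 2 * π) + 2)
    (isOpen_Ioo.preimage Complex.continuous_im) (fun Y hY hexp => ?_) (injOn_stripSheet m)
    ⟨crit m + π * Complex.I, ?_, ?_⟩ (fun Y hY => ?_) fun Y hY hW => ?_
  · obtain ⟨n, rfl⟩ := Complex.exp_eq_one_iff.1 hexp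
    have hY : 2 * π * m < 2 * π * n ∧ 2 * π * n < 2 * π * (m + 1) := by
      simpa [mul_comm (n : ℝ)] using hY
    have hmn : (m : ℝ) < n := lt_of_mul_lt_mul_left hY.1 (by positivity)
    have hnm : (n : ℝ) < m + 1 := lt_of_mul_lt_mul_left hY.2 (by positivity)
    norm_cast at hmn hnm
    lia
  · simp only [mem_ofPred_eq, Complex.add_im, crit_im, Complex.im_ofReal_mul, Complex.I_im, mul_one]
    constructor <;> linarith
  · simp [W₀_eq, Complex.exp_add]
  · rw [← add_assoc]
    refine norm_le_of_abs_im_le (abs_le.2 ?_)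
    constructor <;> linarith [hY.1, hY.2, neg_abs_le (2 * π * m), le_abs_self (2 * π * m)]
  · have hIcc : Y.im ∈ Icc (2 * π * m) (2 * π * (m + 1)) :=
      closure_minimal (preimage_mono Ioo_subset_Icc_self)
        (isClosed_Icc.preimage Complex.continuous_im) hY
    have hW := mem_halfPlane_I.1 hW
    refine ⟨hIcc.1.lt_of_ne' (im_ne_of_W₀_re_pos hW m), hIcc.2.lt_of_ne ?_⟩
    exact_mod_cast im_ne_of_W₀_re_pos hW (m + 1)

/-! ### Sheets adjacent to a critical point -/

/-- Two sheets of `W₀` over the same half-plane which are adjacent to the critical point `0` and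
lie on different sides of it with respect to the direction `dir`. Every thimble through `0` with
phase in `halfPlane dir` consists of `0` and one arc in each sheet. -/
structure SheetPair where
  dir : ℂ
  pos : Set ℂ
  neg : Set ℂ
  isSheet_pos : IsSheet dir pos
  isSheet_neg : IsSheet dir neg
  re_pos : ∀ Y ∈ pos, 0 < (conj dir * Y).re
  re_neg : ∀ Y ∈ neg, (conj dir * Y).re < 0
  eventually_mem : ∀ᶠ Y in 𝓝 0, W₀ Y ∈ halfPlane dir → Y ∈ pos ∪ neg

/-- The sheets adjacent to `0` over the left half-plane. -/
def leftPair : SheetPair where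
  dir := 1
  pos := rightSheet
  neg := leftSheet
  isSheet_pos := isSheet_rightSheet
  isSheet_neg := isSheet_leftSheet
  re_pos Y hY := by simpa using hY.1.1
  re_neg Y hY := by simpa using hY.1
  eventually_mem := by
    have hnear : ∀ᶠ Y : ℂ in 𝓝 0, |Y.im| < π / 2 :=
      (Complex.continuous_im.abs.tendsto' 0 0 (by simp)).eventually_lt_const (by positivity)
    filter_upwards [hnear] with Y him hW
    rcases lt_or_gt_of_ne (re_ne_zero_of_W₀_re_neg (mem_halfPlane_one.1 hW)) with hre | hre
    · exact Or.inr ⟨hre, hW⟩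
    · exact Or.inl ⟨⟨hre, him⟩, hW⟩

/-- The sheets adjacent to `0` over the right half-plane. -/
def rightPair : SheetPair where
  dir := Complex.I
  pos := stripSheet 0
  neg := stripSheet (-1)
  isSheet_pos := isSheet_stripSheet 0
  isSheet_neg := isSheet_stripSheet (-1)
  re_pos Y hY := by simpa using hY.1.1
  re_neg Y hY := by simpa using hY.1.2
  eventually_mem := by
    have hnear : ∀ᶠ Y : ℂ in 𝓝 0, |Y.im| < 2 * π :=
      (Complex.continuous_im.abs.tendsto' 0 0 (by simp)).eventually_lt_const (by positivity)
    filter_upwards [hnear] with Y him hW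
    obtain ⟨hlt, hgt⟩ := abs_lt.1 him
    rcases lt_or_gt_of_ne (im_ne_of_W₀_re_pos (mem_halfPlane_I.1 hW) 0) with hre | hre
    · exact Or.inr ⟨⟨by simpa using hlt, by simpa using hre⟩, hW⟩
    · exact Or.inl ⟨⟨by simpa using hre, by simpa using hgt⟩, hW⟩

namespace SheetPair

variable {P : SheetPair}

/-- The same sheets in the opposite order. -/
def symm (P : SheetPair) : SheetPair where
  dir := -P.dir
  pos := P.neg
  neg := P.pos
  isSheet_pos := ⟨P.isSheet_neg.isOpen, P.isSheet_neg.exp_ne_one,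
    by simpa using P.isSheet_neg.bijOn, by simpa using P.isSheet_neg.mem_of_mem_closure⟩
  isSheet_neg := ⟨P.isSheet_pos.isOpen, P.isSheet_pos.exp_ne_one,
    by simpa using P.isSheet_pos.bijOn, by simpa using P.isSheet_pos.mem_of_mem_closure⟩
  re_pos Y hY := by simpa only [map_neg, neg_mul, Complex.neg_re, neg_pos] using P.re_neg Y hY
  re_neg Y hY := by
    simpa only [map_neg, neg_mul, Complex.neg_re, neg_lt_zero] using P.re_pos Y hY
  eventually_mem := by simpa [or_comm] using P.eventually_mem

lemma isOpen_union (P : SheetPair) : IsOpen (P.pos ∪ P.neg) :=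
  P.isSheet_pos.isOpen.union P.isSheet_neg.isOpen

lemma mem_of_mem_closure {Y : ℂ} (hY : Y ∈ closure (P.pos ∪ P.neg))
    (hW : W₀ Y ∈ halfPlane P.dir) : Y ∈ P.pos ∪ P.neg := by
  rw [closure_union] at hY
  exact hY.imp (P.isSheet_pos.mem_of_mem_closure Y · hW) (P.isSheet_neg.mem_of_mem_closure Y · hW)

lemma subset_of_isPreconnected {K : Set ℂ} (hK : IsPreconnected K) (hzero : 0 ∈ closure K)
    (hW : ∀ Y ∈ K, Y ≠ 0 → W₀ Y ∈ halfPlane P.dir) : K ⊆ insert 0 (P.pos ∪ P.neg) := by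
  set near : Set ℂ := interior {Y | W₀ Y ∈ halfPlane P.dir → Y ∈ P.pos ∪ P.neg}
  have hsub : P.pos ∪ P.neg ⊆ near := interior_maximal (fun _ hY _ => hY) P.isOpen_union
  have hmem_near : 0 ∈ near := mem_interior_iff_mem_nhds.2 P.eventually_mem
  set far : Set ℂ := (closure (P.pos ∪ P.neg))ᶜ ∩ W₀ ⁻¹' halfPlane P.dir
  have hfar_open : IsOpen far :=
    isClosed_closure.isOpen_compl.inter ((isOpen_halfPlane _).preimage continuous_W₀)
  have hdisjoint : Disjoint near far := Set.disjoint_left.2 fun Y hn hf =>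
    hf.1 (subset_closure (interior_subset hn hf.2))
  have hcover : K ⊆ near ∪ far := fun Y hY => by
    by_cases hY0 : Y = 0
    · exact Or.inl (hY0 ▸ hmem_near)
    · by_cases hYcl : Y ∈ closure (P.pos ∪ P.neg)
      · exact Or.inl (hsub (mem_of_mem_closure hYcl (hW Y hY hY0)))
      · exact Or.inr ⟨hYcl, hW Y hY hY0⟩
  have hKnear : K ⊆ near := hK.subset_left_of_subset_union isOpen_interior hfar_open hdisjoint
    hcover ((mem_closure_iff.1 hzero near isOpen_interior hmem_near).mono (inter_comm _ _).subset)
  exact fun Y hY => or_iff_not_imp_left.2 fun hY0 => interior_subset (hKnear hY) (hW Y hY hY0)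

end SheetPair

lemma exists_analyticAt_rightInverse {𝕜 : Type*} [NontriviallyNormedField 𝕜] [CompleteSpace 𝕜]
    [CharZero 𝕜] {f : 𝕜 → 𝕜} {a : 𝕜} (hf : AnalyticAt 𝕜 f a) (hf' : deriv f a ≠ 0) :
    ∃ g : 𝕜 → 𝕜, AnalyticAt 𝕜 g (f a) ∧ g (f a) = a ∧
      HasDerivAt g (deriv f a)⁻¹ (f a) ∧ ∀ᶠ w in 𝓝 (f a), f (g w) = w :=
  ⟨hf.hasStrictDerivAt.localInverse f _ a hf', hf.analyticAt_localInverse hf',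
    HasStrictFDerivAt.localInverse_apply_image _,
    (hf.hasStrictDerivAt.to_localInverse hf').hasDerivAt,
    hf.hasStrictDerivAt.eventually_right_inverse hf'⟩

/-- **The Morse lemma** in one complex variable. -/
lemma exists_morse_coordinate {f : ℂ → ℂ} (hf : AnalyticAt ℂ f 0) (hf' : deriv f 0 = 0)
    (hf'' : iteratedDeriv 2 f 0 ≠ 0) : ∃ ψ : ℂ → ℂ, AnalyticAt ℂ ψ 0 ∧ ψ 0 = 0 ∧
      HasDerivAt ψ 1 0 ∧ ∀ᶠ z in 𝓝 0, f (ψ z) = f 0 + iteratedDeriv 2 f 0 / 2 * z ^ 2 := by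
  set c := iteratedDeriv 2 f 0 with hc
  obtain ⟨F, hF, hTaylor⟩ := hf.exists_eq_sum_add_pow_mul 3
  set h : ℂ → ℂ := fun z => 1 + 2 / c * (z * F z) with hh
  have hfh : ∀ z, f z = f 0 + c / 2 * (z ^ 2 * h z) := fun z => by
    rw [hTaylor z]
    simp only [Finset.sum_range_succ, Finset.sum_range_zero, iteratedDeriv_zero,
      iteratedDeriv_one, hf', ← hc, hh, smul_eq_mul, Nat.factorial]
    field_simp
    push_cast
    ring
  have hroot : AnalyticAt ℂ (fun z => h z ^ ((2 : ℕ)⁻¹ : ℂ)) 0 :=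
    (analyticAt_const.add (analyticAt_const.mul (analyticAt_id.mul hF))).cpow analyticAt_const
      (by simp)
  set g : ℂ → ℂ := fun z => z * h z ^ ((2 : ℕ)⁻¹ : ℂ) with hg
  have hga : AnalyticAt ℂ g 0 := analyticAt_id.mul hroot
  have hg0 : g 0 = 0 := zero_mul _
  have hg' : deriv g 0 = 1 :=
    ((hasDerivAt_id (0 : ℂ)).mul hroot.differentiableAt.hasDerivAt).deriv.trans (by simp [hh])
  obtain ⟨ψ, hψ, hψ0, hψ', hgψ⟩ := exists_analyticAt_rightInverse hga (by simp [hg'])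
  rw [hg', inv_one] at hψ'
  rw [hg0] at hψ hψ0 hψ' hgψ
  refine ⟨ψ, hψ, hψ0, hψ', hgψ.mono fun z hz => ?_⟩
  have hsq : ψ z ^ 2 * h (ψ z) = z ^ 2 := by
    rw [← congrArg (· ^ 2) hz, hg, mul_pow, Complex.cpow_nat_inv_pow _ two_ne_zero]
  rw [hfh, hsq]

lemma iteratedDeriv_two_W₀ (Y : ℂ) : iteratedDeriv 2 W₀ Y = -Complex.exp Y := by
  simp [iteratedDeriv_succ, deriv_W₀]

lemma exists_arc_of_sq_eq_neg {ζ σ : ℂ} (hσ : σ ^ 2 = -ζ) : ∃ α : ℝ → ℂ, ContDiffAt ℝ 1 α 0 ∧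
    HasDerivAt α (√2 * σ) 0 ∧ α 0 = 0 ∧ ∀ᶠ s : ℝ in 𝓝 0, W₀ (α s) = ζ * s ^ 2 := by
  obtain ⟨ψ, hψ, hψ0, hψ', hW⟩ := exists_morse_coordinate (analyticAt_W₀ 0) (by simp [deriv_W₀])
    (by simp [iteratedDeriv_two_W₀])
  have hline : HasDerivAt (fun s : ℝ => √2 * σ * s) (√2 * σ) 0 := by
    simpa using (Complex.ofRealCLM.hasDerivAt (x := 0)).const_mul (√2 * σ)
  have hline0 : Tendsto (fun s : ℝ => √2 * σ * s) (𝓝 0) (𝓝 0) :=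
    Continuous.tendsto' (by fun_prop) _ _ (by simp)
  have hzero : (√2 * σ * (0 : ℝ) : ℂ) = 0 := by simp
  refine ⟨fun s => ψ (√2 * σ * s), ?_, ?_, by simp [hψ0], ?_⟩
  · rw [← hzero] at hψ
    exact (hψ.contDiffAt.restrict_scalars ℝ).comp (0 : ℝ)
      (contDiffAt_const.mul Complex.ofRealCLM.contDiff.contDiffAt)
  · rw [← hzero] at hψ'
    exact (hψ'.comp (0 : ℝ) hline).congr_deriv (one_mul _)
  · filter_upwards [hline0.eventually hW] with s hs
    have hsqrt : (√2 : ℂ) ^ 2 = 2 := by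
      exact_mod_cast congrArg Complex.ofReal (Real.sq_sqrt zero_le_two)
    rw [hs, W₀_zero, iteratedDeriv_two_W₀, Complex.exp_zero, mul_pow, mul_pow, hσ, hsqrt]
    ring

/-! ### Gradient trajectories -/

lemma surjective_of_le_deriv {f : ℝ → ℝ} (hf : Differentiable ℝ f) {c : ℝ} (hc : 0 < c)
    (hf' : ∀ x, c ≤ deriv f x) : Function.Surjective f := by
  refine hf.continuous.surjective ?_ ?_
  · refine tendsto_atTop_mono' _ ?_
      (tendsto_atTop_add_const_right _ (f 0) (tendsto_id.const_mul_atTop hc))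
    filter_upwards [eventually_ge_atTop 0] with x hx
    simpa using add_le_of_le_sub_right (mul_sub_le_image_sub_of_le_deriv hf hf' hx)
  · refine tendsto_atBot_mono' _ ?_
      (tendsto_atBot_add_const_right _ (f 0) (tendsto_id.const_mul_atBot hc))
    filter_upwards [eventually_le_atBot 0] with x hx
    have hgrowth := mul_sub_le_image_sub_of_le_deriv hf hf' hx
    simp only [id]
    linarith

lemma exists_orderIso_hasDerivAt_inv {m : ℝ → ℝ} (hm : Continuous m) {c : ℝ} (hc : 0 < c)
    (hcm : ∀ y, c ≤ m y) (y₀ : ℝ) :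
    ∃ τ : ℝ ≃o ℝ, τ 0 = y₀ ∧ ∀ x, HasDerivAt τ (m (τ x))⁻¹ x := by
  have hderiv : ∀ y, HasDerivAt (fun y => ∫ z in y₀..y, m z) (m y) y := fun y =>
    (hm.integral_hasStrictDerivAt y₀ y).hasDerivAt
  have hpos : ∀ y, 0 < m y := fun y => hc.trans_le (hcm y)
  set e : ℝ ≃o ℝ := StrictMono.orderIsoOfSurjective (fun y => ∫ z in y₀..y, m z)
    (strictMono_of_deriv_pos fun y => (hpos y).trans_eq (hderiv y).deriv.symm)
    (surjective_of_le_deriv (fun y => (hderiv y).differentiableAt) hc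
      fun y => (hcm y).trans_eq (hderiv y).deriv.symm) with he
  refine ⟨e.symm, (OrderIso.symm_apply_eq e).2 (by simp [he]), fun x => ?_⟩
  exact (hderiv _).of_local_left_inverse e.symm.continuous.continuousAt (hpos _).ne'
    (Eventually.of_forall e.apply_symm_apply)

lemma one_sub_exp_mul_eq_of_W₀_eq {γ : ℝ → ℂ} {ζ : ℂ} (hW : ∀ s : ℝ, W₀ (γ s) = ζ * s ^ 2)
    {v : ℂ} {s : ℝ} (hγ : HasDerivAt γ v s) : (1 - Complex.exp (γ s)) * v = ζ * (2 * s) := by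
  refine ((hasDerivAt_W₀ (γ s)).comp s hγ).unique ?_
  simpa [Function.comp_def, hW] using ((Complex.ofRealCLM.hasDerivAt (x := s)).pow 2).const_mul ζ

lemma gradField_eq_smul_of_W₀_eq {γ : ℝ → ℂ} {ζ : ℂ} (hζ : ζ ≠ 0)
    (hW : ∀ s : ℝ, W₀ (γ s) = ζ * s ^ 2) {v : ℂ} {s : ℝ} (hγ : HasDerivAt γ v s) (hv : v ≠ 0) :
    gradField ζ (γ s) = (s * (‖v‖ ^ 2 / 2)⁻¹) • v := by
  have hconj : conj v ≠ 0 := (map_ne_zero _).2 hv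
  have hexp : ζ⁻¹ * (1 - Complex.exp (γ s)) = 2 * s / v := by
    rw [eq_div_iff hv, mul_assoc, one_sub_exp_mul_eq_of_W₀_eq hW hγ, inv_mul_cancel_left₀ hζ]
  rw [gradField_apply, hexp, Complex.real_smul]
  simp only [map_div₀, map_mul, map_ofNat, Complex.conj_ofReal, Complex.ofReal_mul,
    Complex.ofReal_inv, Complex.ofReal_div, Complex.ofReal_pow, Complex.ofReal_ofNat,
    ← Complex.mul_conj']
  field_simp

lemma mem_L_of_W₀_eq {γ : ℝ → ℂ} {ζ : ℂ} (hζ : ζ ≠ 0) (hγ : ContDiff ℝ 1 γ)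
    (hne : ∀ s, deriv γ s ≠ 0) (hzero : γ 0 = 0) (hW : ∀ s : ℝ, W₀ (γ s) = ζ * s ^ 2) {s₀ : ℝ}
    (hs₀ : 0 < s₀) : γ s₀ ∈ L 0 ζ := by
  have hcont : Continuous (deriv γ) := hγ.continuous_deriv le_rfl
  obtain ⟨s₁, -, hmin⟩ := isCompact_Icc.exists_isMinOn (nonempty_Icc.2 hs₀.le)
    (hcont.norm.continuousOn (s := Icc 0 s₀))
  -- The trajectory is `γ (e ^ τ)`; truncating at `s₀` bounds the velocity from below.
  obtain ⟨τ, hτ0, hτ⟩ := exists_orderIso_hasDerivAt_inv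
    (m := fun y => ‖deriv γ (min (Real.exp y) s₀)‖ ^ 2 / 2) (by fun_prop)
    (c := ‖deriv γ s₁‖ ^ 2 / 2) (by have := norm_pos_iff.2 (hne s₁); positivity) (fun y => by
      have hle : ‖deriv γ s₁‖ ≤ ‖deriv γ (min (Real.exp y) s₀)‖ :=
        hmin ⟨le_min (Real.exp_pos y).le hs₀.le, min_le_right _ _⟩
      gcongr) (Real.log s₀)
  refine ⟨fun x => γ (Real.exp (τ x)), fun x hx => HasDerivAt.hasDerivWithinAt ?_,
    by simp [hτ0, Real.exp_log hs₀], ?_⟩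
  · have hle : Real.exp (τ x) ≤ s₀ := by
      rw [← Real.exp_log hs₀, ← hτ0]
      exact Real.exp_le_exp.2 (τ.monotone hx)
    have hγ' := (hγ.differentiable one_ne_zero (Real.exp (τ x))).hasDerivAt
    refine (hγ'.scomp x (hτ x).exp).congr_deriv ?_
    beta_reduce
    rw [gradField_eq_smul_of_W₀_eq hζ hW hγ' (hne _), min_eq_left hle]
  · simpa [hzero, Function.comp_def] using
      (hγ.continuous.tendsto 0).comp (Real.tendsto_exp_atBot.comp τ.tendsto_atBot)

lemma eq_of_hasDerivWithinAt_zero {E : Type*} [NormedAddCommGroup E] [NormedSpace ℝ E] {f : ℝ → E}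
    {x : ℝ} {a : E} (hf : ∀ y ∈ Iic x, HasDerivWithinAt f 0 (Iic x) y)
    (hlim : Tendsto f atBot (𝓝 a)) : f x = a := by
  refine tendsto_nhds_unique_of_eventuallyEq tendsto_const_nhds hlim ?_
  filter_upwards [eventually_le_atBot x] with y hy
  simpa [sub_eq_zero] using (convex_Iic x).norm_image_sub_le_of_norm_hasDerivWithin_le hf
    (fun _ _ => norm_zero.le) hy self_mem_Iic

lemma le_and_eq_of_hasDerivWithinAt_norm_sq {E : Type*} [NormedAddCommGroup E] [NormedSpace ℝ E]
    {Γ Γ' : ℝ → E} {u : ℝ → ℝ} {x b : ℝ} {a : E}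
    (hΓ : ∀ y ∈ Iic x, HasDerivWithinAt Γ (Γ' y) (Iic x) y) (hΓlim : Tendsto Γ atBot (𝓝 a))
    (hu : ∀ y ∈ Iic x, HasDerivWithinAt u (‖Γ' y‖ ^ 2) (Iic x) y)
    (hulim : Tendsto u atBot (𝓝 b)) : b ≤ u x ∧ (u x = b → Γ x = a) := by
  have hmono : MonotoneOn u (Iic x) := monotoneOn_of_hasDerivWithinAt_nonneg (convex_Iic x)
    (fun y hy => (hu y hy).continuousWithinAt)
    (fun y hy => (hu y (interior_subset hy)).mono interior_subset) fun y _ => sq_nonneg ‖Γ' y‖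
  have hle : ∀ y ∈ Iic x, b ≤ u y := fun y hy => by
    refine le_of_tendsto hulim ?_
    filter_upwards [eventually_le_atBot y] with z hz using hmono (hz.trans hy) hy hz
  refine ⟨hle x self_mem_Iic, fun hb => eq_of_hasDerivWithinAt_zero (fun y hy => ?_) hΓlim⟩
  have hconst : ∀ z ∈ Iic x, u z = b := fun z hz =>
    le_antisymm (hb ▸ hmono hz self_mem_Iic hz) (hle z hz)
  have hzero : ‖Γ' y‖ ^ 2 = 0 := (uniqueDiffOn_Iic x y hy).eq_deriv _ (hu y hy)
    ((hasDerivWithinAt_const y _ b).congr hconst (hconst y hy))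
  simpa [norm_eq_zero.1 (pow_eq_zero_iff two_ne_zero |>.1 hzero)] using hΓ y hy

lemma exists_W₀_eq_of_isIntegralCurveOn {ζ : ℂ} (hζ : ζ ≠ 0) {Γ : ℝ → ℂ} {x : ℝ}
    (hΓ : IsIntegralCurveOn Γ (fun _ => gradField ζ) (Iic x)) (hlim : Tendsto Γ atBot (𝓝 0)) :
    ∃ s : ℝ, 0 ≤ s ∧ W₀ (Γ x) = ζ * s ^ 2 ∧ (s = 0 → Γ x = 0) := by
  set F : ℝ → ℂ := fun y => ζ⁻¹ * W₀ (Γ y) with hF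
  have hderiv : ∀ y ∈ Iic x,
      HasDerivWithinAt F ((‖gradField ζ (Γ y)‖ ^ 2 : ℝ) : ℂ) (Iic x) y := fun y hy => by
    refine (((hasDerivAt_W₀ (Γ y)).comp_hasDerivWithinAt y (hΓ y hy)).const_mul ζ⁻¹).congr_deriv ?_
    beta_reduce
    rw [← mul_assoc, gradField_apply, Complex.mul_conj', RCLike.norm_conj, Complex.ofReal_pow]
  have hFlim : Tendsto F atBot (𝓝 0) := by
    simpa using ((continuous_W₀.tendsto 0).comp hlim).const_mul ζ⁻¹
  have him : (F x).im = 0 := eq_of_hasDerivWithinAt_zero (f := fun y => (F y).im)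
    (fun y hy => (Complex.imCLM.hasFDerivAt.comp_hasDerivWithinAt y (hderiv y hy)).congr_deriv
      (by simp only [Complex.imCLM_apply, Complex.ofReal_im]))
    ((Complex.continuous_im.tendsto 0).comp hFlim)
  obtain ⟨hnonneg, hrest⟩ := le_and_eq_of_hasDerivWithinAt_norm_sq (u := fun y => (F y).re) hΓ hlim
    (fun y hy => Complex.reCLM.hasFDerivAt.comp_hasDerivWithinAt y (hderiv y hy))
    ((Complex.continuous_re.tendsto 0).comp hFlim)
  rw [Complex.zero_re] at hnonneg
  refine ⟨√(F x).re, Real.sqrt_nonneg _, ?_, fun h => hrest ((Real.sqrt_eq_zero hnonneg).1 h)⟩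
  have hreal : ((F x).re : ℂ) = F x := Complex.ext rfl (by simp [him])
  rw [← Complex.ofReal_pow, Real.sq_sqrt hnonneg, hreal, hF, mul_inv_cancel_left₀ hζ]

/-! ### Regular parametrisations of the thimbles -/

lemma IsSheet.contDiffAt_of_comp {μ : ℂ} {U : Set ℂ} (hU : IsSheet μ U) {γ : ℝ → ℂ} {s : ℝ}
    {n : WithTop ℕ∞} (hγ : ∀ᶠ t in 𝓝 s, γ t ∈ U) (hW : ContDiffAt ℝ n (W₀ ∘ γ) s) :
    ContDiffAt ℝ n γ s := by
  have hmem : γ s ∈ U := hγ.self_of_nhds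
  obtain ⟨g, hg, hgs, -, hWg⟩ := exists_analyticAt_rightInverse (analyticAt_W₀ (γ s)) <| by
    rw [deriv_W₀]
    exact sub_ne_zero.2 (hU.exp_ne_one _ hmem).symm
  have hnear : ∀ᶠ t in 𝓝 s, g (W₀ (γ t)) ∈ U :=
    (ContinuousAt.comp (f := W₀ ∘ γ) hg.continuousAt hW.continuousAt).eventually_mem
      (hU.isOpen.mem_nhds (by rwa [Function.comp_apply, Function.comp_apply, hgs]))
  refine ((hg.contDiffAt.restrict_scalars ℝ).comp s hW).congr_of_eventuallyEq ?_
  filter_upwards [hγ, hnear, hW.continuousAt.eventually hWg] with t ht hgt hWt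
  exact hU.bijOn.injOn ht hgt hWt.symm

/-- `γ` parametrises the Lefschetz thimble through the critical point `0` with phase `ζ`. The
parameter is the signed square root of the height `ζ⁻¹ W₀`, and `σ` is the tangent direction
pointing from the sheet `P.neg` into the sheet `P.pos`. -/
structure IsThimbleParam (P : SheetPair) (ζ σ : ℂ) (γ : ℝ → ℂ) : Prop where
  W₀_eq : ∀ s : ℝ, W₀ (γ s) = ζ * s ^ 2
  mem_pos : ∀ s > 0, γ s ∈ P.pos
  mem_neg : ∀ s < 0, γ s ∈ P.neg
  map_zero : γ 0 = 0
  sq_eq_neg : σ ^ 2 = -ζ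
  re_pos : 0 < (conj P.dir * σ).re

lemma exists_isThimbleParam {P : SheetPair} {ζ σ : ℂ} (hζ : ζ ∈ halfPlane P.dir)
    (hσ : σ ^ 2 = -ζ) (hdir : 0 < (conj P.dir * σ).re) : ∃ γ, IsThimbleParam P ζ σ γ := by
  have hray : ∀ s : ℝ, s ≠ 0 → ζ * s ^ 2 ∈ halfPlane P.dir := fun s hs => by
    exact_mod_cast mul_ofReal_mem_halfPlane hζ (sq_pos_of_ne_zero hs)
  choose! p hp hWp using fun w (hw : w ∈ halfPlane P.dir) => P.isSheet_pos.bijOn.surjOn hw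
  choose! n hn hWn using fun w (hw : w ∈ halfPlane P.dir) => P.isSheet_neg.bijOn.surjOn hw
  refine ⟨fun s => if 0 < s then p (ζ * s ^ 2) else if s < 0 then n (ζ * s ^ 2) else 0,
    fun s => ?_, fun s hs => ?_, fun s hs => ?_, by simp, hσ, hdir⟩
  · split_ifs with hpos hneg
    · exact hWp _ (hray s hpos.ne')
    · exact hWn _ (hray s hneg.ne)
    · simp [le_antisymm (not_lt.1 hpos) (not_lt.1 hneg)]
  · simpa only [if_pos hs] using hp _ (hray s (ne_of_gt hs))
  · simpa only [if_neg (not_lt.2 (le_of_lt hs)), if_pos hs] using hn _ (hray s (ne_of_lt hs))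

namespace IsThimbleParam

variable {P : SheetPair} {ζ σ : ℂ} {γ : ℝ → ℂ}

lemma phase_mem (h : IsThimbleParam P ζ σ γ) : ζ ∈ halfPlane P.dir := by
  simpa [h.W₀_eq] using P.isSheet_pos.bijOn.mapsTo (h.mem_pos 1 one_pos)

lemma phase_ne_zero (h : IsThimbleParam P ζ σ γ) : ζ ≠ 0 := by
  rintro rfl
  simpa [halfPlane] using h.phase_mem

lemma comp_neg (h : IsThimbleParam P ζ σ γ) :
    IsThimbleParam P.symm ζ (-σ) (fun s => γ (-s)) where
  W₀_eq s := by simpa using h.W₀_eq (-s)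
  mem_pos s hs := h.mem_neg (-s) (neg_lt_zero.2 hs)
  mem_neg s hs := h.mem_pos (-s) (neg_pos.2 hs)
  map_zero := by simpa using h.map_zero
  sq_eq_neg := by rw [neg_sq, h.sq_eq_neg]
  re_pos := by simpa [SheetPair.symm] using h.re_pos

lemma eventuallyEq_of_hasDerivAt (h : IsThimbleParam P ζ σ γ) {α : ℝ → ℂ} {v : ℂ}
    (hzero : α 0 = 0) (hα : HasDerivAt α v 0) (hv : 0 < (conj P.dir * v).re)
    (hW : ∀ᶠ s : ℝ in 𝓝 0, W₀ (α s) = ζ * s ^ 2) : γ =ᶠ[𝓝 0] α := by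
  have hside : HasDerivAt (fun s => (conj P.dir * α s).re) (conj P.dir * v).re 0 :=
    Complex.reCLM.hasFDerivAt.comp_hasDerivAt (0 : ℝ) (hα.const_mul (conj P.dir))
  have hsign : ∀ᶠ s in 𝓝 0, SignType.sign (conj P.dir * α s).re = SignType.sign s := by
    simpa only [nhdsWithin_univ, sub_zero] using
      eventually_nhdsWithin_sign_eq_of_deriv_pos (x₀ := 0) (by rwa [hside.deriv])
        (by simp [hzero])
  have hmem : ∀ᶠ s in 𝓝 0, W₀ (α s) ∈ halfPlane P.dir → α s ∈ P.pos ∪ P.neg :=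
    (hzero ▸ hα.continuousAt.tendsto : Tendsto α (𝓝 0) (𝓝 0)).eventually P.eventually_mem
  filter_upwards [hW, hsign, hmem] with s hWs hsigns hmems
  rw [← h.W₀_eq] at hWs
  rcases lt_trichotomy s 0 with hs | rfl | hs
  · have hγs := h.mem_neg s hs
    rw [sign_neg hs, sign_eq_neg_one_iff] at hsigns
    rcases hmems (hWs ▸ P.isSheet_neg.bijOn.mapsTo hγs) with hαs | hαs
    · exact absurd (P.re_pos _ hαs) hsigns.not_gt
    · exact P.isSheet_neg.bijOn.injOn hγs hαs hWs.symm
  · rw [h.map_zero, hzero]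
  · have hγs := h.mem_pos s hs
    rw [sign_pos hs, sign_eq_one_iff] at hsigns
    rcases hmems (hWs ▸ P.isSheet_pos.bijOn.mapsTo hγs) with hαs | hαs
    · exact P.isSheet_pos.bijOn.injOn hγs hαs hWs.symm
    · exact absurd (P.re_neg _ hαs) hsigns.not_gt

lemma eventuallyEq_arc (h : IsThimbleParam P ζ σ γ) :
    ∃ α : ℝ → ℂ, ContDiffAt ℝ 1 α 0 ∧ HasDerivAt α (√2 * σ) 0 ∧ γ =ᶠ[𝓝 0] α := by
  obtain ⟨α, hα, hα', hzero, hW⟩ := exists_arc_of_sq_eq_neg h.sq_eq_neg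
  refine ⟨α, hα, hα', h.eventuallyEq_of_hasDerivAt hzero hα' ?_ hW⟩
  rw [mul_left_comm, Complex.re_ofReal_mul]
  exact mul_pos (by positivity) h.re_pos

lemma hasDerivAt_zero (h : IsThimbleParam P ζ σ γ) : HasDerivAt γ (√2 * σ) 0 := by
  obtain ⟨α, -, hα, hγα⟩ := h.eventuallyEq_arc
  exact hα.congr_of_eventuallyEq hγα

lemma contDiff (h : IsThimbleParam P ζ σ γ) : ContDiff ℝ 1 γ := by
  have hW : ContDiff ℝ 1 (W₀ ∘ γ) := by
    rw [show W₀ ∘ γ = _ from funext h.W₀_eq]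
    exact contDiff_const.mul (Complex.ofRealCLM.contDiff.pow 2)
  refine contDiff_iff_contDiffAt.2 fun s => ?_
  rcases lt_trichotomy s 0 with hs | rfl | hs
  · exact P.isSheet_neg.contDiffAt_of_comp ((gt_mem_nhds hs).mono h.mem_neg) hW.contDiffAt
  · obtain ⟨α, hα, -, hγα⟩ := h.eventuallyEq_arc
    exact hα.congr_of_eventuallyEq hγα
  · exact P.isSheet_pos.contDiffAt_of_comp ((lt_mem_nhds hs).mono h.mem_pos) hW.contDiffAt

lemma exp_mul_deriv (h : IsThimbleParam P ζ σ γ) (s : ℝ) :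
    (1 - Complex.exp (γ s)) * deriv γ s = ζ * (2 * s) :=
  one_sub_exp_mul_eq_of_W₀_eq h.W₀_eq (h.contDiff.differentiable one_ne_zero s).hasDerivAt

lemma dir_ne_zero (h : IsThimbleParam P ζ σ γ) : σ ≠ 0 := by
  rintro rfl
  simpa using h.re_pos

lemma deriv_ne_zero (h : IsThimbleParam P ζ σ γ) (s : ℝ) : deriv γ s ≠ 0 := by
  rcases eq_or_ne s 0 with rfl | hs
  · rw [h.hasDerivAt_zero.deriv]
    exact mul_ne_zero (by simp) h.dir_ne_zero
  · refine right_ne_zero_of_mul (a := 1 - Complex.exp (γ s)) ?_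
    rw [h.exp_mul_deriv]
    exact mul_ne_zero h.phase_ne_zero (mul_ne_zero two_ne_zero (Complex.ofReal_ne_zero.2 hs))

lemma injective (h : IsThimbleParam P ζ σ γ) : Function.Injective γ := by
  intro s t hst
  have hopposite : ∀ s t, 0 < s → t < 0 → γ s ≠ γ t := fun s t hs ht heq =>
    (P.re_pos _ (h.mem_pos s hs)).not_gt (heq ▸ P.re_neg _ (h.mem_neg t ht))
  have hsq : s ^ 2 = t ^ 2 := by
    have hW := congrArg W₀ hst
    rw [h.W₀_eq, h.W₀_eq, mul_right_inj' h.phase_ne_zero] at hW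
    exact_mod_cast hW
  rcases sq_eq_sq_iff_eq_or_eq_neg.1 hsq with hsame | rfl
  · exact hsame
  · rcases lt_trichotomy t 0 with ht | rfl | ht
    · exact absurd hst (hopposite _ _ (neg_pos.2 ht) ht)
    · exact neg_zero
    · exact absurd hst.symm (hopposite _ _ ht (neg_neg_of_pos ht))

lemma isEmbedding (h : IsThimbleParam P ζ σ γ) : IsEmbedding γ := by
  have hproper : IsProperMap (W₀ ∘ γ) := by
    refine isProperMap_iff_tendsto_cocompact.2 ⟨continuous_W₀.comp h.contDiff.continuous, ?_⟩
    rw [← Metric.cobounded_eq_cocompact, ← Metric.cobounded_eq_cocompact,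
      ← tendsto_norm_atTop_iff_cobounded]
    simp only [Function.comp_apply, h.W₀_eq, norm_mul, norm_pow, Complex.norm_real]
    exact ((tendsto_pow_atTop two_ne_zero).comp tendsto_norm_cobounded_atTop).const_mul_atTop
      (norm_pos_iff.2 h.phase_ne_zero)
  exact (IsClosedEmbedding.of_continuous_injective_isClosedMap h.contDiff.continuous h.injective
    (isProperMap_of_comp_of_t2 h.contDiff.continuous continuous_W₀ hproper).isClosedMap).isEmbedding

lemma range_subset_L (h : IsThimbleParam P ζ σ γ) : range γ ⊆ L 0 ζ := by
  rintro _ ⟨s, rfl⟩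
  rcases lt_trichotomy s 0 with hs | rfl | hs
  · simpa using mem_L_of_W₀_eq h.phase_ne_zero h.comp_neg.contDiff h.comp_neg.deriv_ne_zero
      h.comp_neg.map_zero h.comp_neg.W₀_eq (neg_pos.2 hs)
  · refine ⟨fun _ => 0, fun x _ => ?_, h.map_zero.symm, by simp⟩
    simpa [gradField_apply] using hasDerivWithinAt_const x (Iic (0 : ℝ)) (0 : ℂ)
  · exact mem_L_of_W₀_eq h.phase_ne_zero h.contDiff h.deriv_ne_zero h.map_zero h.W₀_eq hs

lemma mem_range_of_mem_sheets (h : IsThimbleParam P ζ σ γ) {Y : ℂ} (hY : Y ∈ P.pos ∪ P.neg)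
    {s : ℝ} (hs : 0 < s) (hW : W₀ Y = ζ * s ^ 2) : Y ∈ range γ := by
  rcases hY with hY | hY
  · exact ⟨s, P.isSheet_pos.bijOn.injOn (h.mem_pos s hs) hY ((h.W₀_eq s).trans hW.symm)⟩
  · refine ⟨-s, P.isSheet_neg.bijOn.injOn (h.mem_neg _ (neg_neg_of_pos hs)) hY ?_⟩
    rw [h.W₀_eq, hW, Complex.ofReal_neg, neg_sq]

lemma L_subset_range (h : IsThimbleParam P ζ σ γ) : L 0 ζ ⊆ range γ := by
  rintro p ⟨Γ, hΓ, rfl, hlim⟩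
  rw [crit_zero] at hlim
  have hW : ∀ x ≤ 0, ∃ s : ℝ, 0 ≤ s ∧ W₀ (Γ x) = ζ * s ^ 2 ∧ (s = 0 → Γ x = 0) := fun x hx =>
    exists_W₀_eq_of_isIntegralCurveOn h.phase_ne_zero (hΓ.mono (Iic_subset_Iic.2 hx)) hlim
  have hsheets : Γ '' Iic 0 ⊆ insert 0 (P.pos ∪ P.neg) := by
    refine SheetPair.subset_of_isPreconnected (isPreconnected_Iic.image Γ hΓ.continuousOn)
      (mem_closure_of_tendsto hlim ((eventually_le_atBot 0).mono fun x hx => ⟨x, hx, rfl⟩)) ?_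
    rintro _ ⟨x, hx, rfl⟩ hne
    obtain ⟨s, hs, hWx, hzero⟩ := hW x hx
    have hs : 0 < s := hs.lt_of_ne' fun hs => hne (hzero hs)
    rw [hWx]
    exact_mod_cast mul_ofReal_mem_halfPlane h.phase_mem (pow_pos hs 2)
  obtain ⟨s, hs, hW0, hzero⟩ := hW 0 le_rfl
  rcases hs.eq_or_lt with hs | hs
  · exact ⟨0, by rw [h.map_zero, hzero hs.symm]⟩
  · refine (hsheets ⟨0, self_mem_Iic, rfl⟩).elim (fun h0 => ⟨0, by rw [h.map_zero, h0]⟩) fun hmem =>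
      h.mem_range_of_mem_sheets hmem hs hW0

lemma isOrientedParam (h : IsThimbleParam P ζ σ γ) (k : ℤ) :
    IsOrientedParam (L k ζ) (crit k) σ (fun s => γ s + crit k) where
  contDiff := h.contDiff.add contDiff_const
  isEmbedding := (Homeomorph.addRight (crit k)).isEmbedding.comp h.isEmbedding
  deriv_ne_zero s := by
    rw [deriv_add_const]
    exact h.deriv_ne_zero s
  range_eq := by
    rw [L_eq_image, ← h.range_subset_L.antisymm h.L_subset_range, ← range_comp]
    rfl
  map_zero := by rw [h.map_zero, zero_add]
  deriv_zero := ⟨√2, by positivity, by rw [deriv_add_const, h.hasDerivAt_zero.deriv,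
    Complex.real_smul]⟩

end IsThimbleParam

lemma IsThimbleParam.exp_eq_one_iff {P : SheetPair} {ζ σ : ℂ} {γ : ℝ → ℂ}
    (h : IsThimbleParam P ζ σ γ) {s : ℝ} : Complex.exp (γ s) = 1 ↔ s = 0 := by
  have hs := h.exp_mul_deriv s
  constructor
  · intro hexp
    simpa [hexp, h.phase_ne_zero] using hs.symm
  · rintro rfl
    rw [h.map_zero, Complex.exp_zero]

/-! ### Orientations -/

lemma isPreconnected_sphere_inter {E : Type*} [NormedAddCommGroup E] [NormedSpace ℝ E]
    {C : Set E} (hC : IsPreconnected C) (hzero : 0 ∉ C)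
    (hcone : ∀ x ∈ C, ∀ r : ℝ, 0 < r → r • x ∈ C) : IsPreconnected (Metric.sphere 0 1 ∩ C) := by
  have hne : ∀ x ∈ C, ‖x‖ ≠ 0 := fun x hx => norm_ne_zero_iff.2 fun h0 => hzero (h0 ▸ hx)
  have himage : (fun x => ‖x‖⁻¹ • x) '' C = Metric.sphere 0 1 ∩ C := by
    ext x
    constructor
    · rintro ⟨y, hy, rfl⟩
      refine ⟨?_, hcone y hy _ (inv_pos.2 (lt_of_le_of_ne' (norm_nonneg y) (hne y hy)))⟩
      rw [mem_sphere_zero_iff_norm, norm_smul, norm_inv, norm_norm, inv_mul_cancel₀ (hne y hy)]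
    · rintro ⟨hx, hxC⟩
      exact ⟨x, hxC, by simp [mem_sphere_zero_iff_norm.1 hx]⟩
  rw [← himage]
  exact hC.image _ ((continuousOn_id.norm.inv₀ hne).smul continuousOn_id)

lemma re_ne_zero_of_sq_re_pos {z : ℂ} (hz : 0 < (z ^ 2).re) : z.re ≠ 0 := by
  intro h0
  rw [sq, Complex.mul_re, h0] at hz
  linarith [mul_self_nonneg z.im]

lemma re_conj_mul_pos {u v : ℂ} (hu : 0 < u.re) (hv : 0 < v.re) (hu2 : 0 < (u ^ 2).re)
    (hv2 : 0 < (v ^ 2).re) : 0 < (conj u * v).re := by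
  have habs : ∀ z : ℂ, 0 < z.re → 0 < (z ^ 2).re → |z.im| < z.re := fun z hz hz2 => by
    rw [sq, Complex.mul_re] at hz2
    exact abs_lt_of_sq_lt_sq (by linarith) hz.le
  have him : |u.im * v.im| < u.re * v.re := by
    rw [abs_mul]
    exact mul_lt_mul'' (habs u hu hu2) (habs v hv hv2) (abs_nonneg _) (abs_nonneg _)
  rw [Complex.mul_re, Complex.conj_re, Complex.conj_im]
  linarith [neg_abs_le (u.im * v.im)]

lemma IsOrientation.neg {o : ℂ → ℂ} (ho : IsOrientation o) : IsOrientation fun ζ => -o ζ :=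
  ⟨ho.1.neg, fun ζ hζ hre => by rw [neg_sq, ho.2 ζ hζ hre]⟩

lemma IsOrientation.forall_re_pos_or_forall_re_neg {o : ℂ → ℂ} (ho : IsOrientation o) {μ : ℂ}
    (hre : ∀ ζ ∈ halfPlane μ, ζ.re ≠ 0) :
    (∀ ζ ∈ Metric.sphere 0 1 ∩ halfPlane μ, 0 < (conj μ * o ζ).re) ∨
      ∀ ζ ∈ Metric.sphere 0 1 ∩ halfPlane μ, (conj μ * o ζ).re < 0 := by
  have hne : ∀ ζ ∈ Metric.sphere 0 1 ∩ halfPlane μ, (conj μ * o ζ).re ≠ 0 := fun ζ hζ => by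
    refine re_ne_zero_of_sq_re_pos ?_
    rw [mul_pow, ho.2 ζ (mem_sphere_zero_iff_norm.1 hζ.1) (hre ζ hζ.2), mul_neg, ← neg_mul]
    exact hζ.2
  have hcont : ContinuousOn (fun ζ => (conj μ * o ζ).re) (Metric.sphere 0 1 ∩ halfPlane μ) :=
    Complex.continuous_re.comp_continuousOn <| continuousOn_const.mul <|
      ho.1.mono fun ζ hζ => ⟨mem_sphere_zero_iff_norm.1 hζ.1, hre ζ hζ.2⟩
  have hconn : IsPreconnected (Metric.sphere 0 1 ∩ halfPlane μ) :=
    isPreconnected_sphere_inter (convex_halfPlane μ).isPreconnected (by simp [halfPlane])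
      fun ζ hζ r hr => by
        rw [Complex.real_smul, mul_comm]
        exact mul_ofReal_mem_halfPlane hζ hr
  have hcover : (fun ζ => (conj μ * o ζ).re) '' (Metric.sphere 0 1 ∩ halfPlane μ) ⊆
      Ioi 0 ∪ Iio 0 := by
    rintro _ ⟨ζ, hζ, rfl⟩
    exact (lt_or_gt_of_ne (hne ζ hζ)).symm
  exact ((hconn.image _ hcont).subset_or_subset isOpen_Ioi isOpen_Iio Ioi_disjoint_Iio_same
    hcover).imp image_subset_iff.1 image_subset_iff.1

lemma IsOrientedParam.comp_neg {C : Set ℂ} {q v : ℂ} {γ : ℝ → ℂ} (h : IsOrientedParam C q v γ) :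
    IsOrientedParam C q (-v) (fun s => γ (-s)) where
  contDiff := h.contDiff.comp contDiff_neg
  isEmbedding := h.isEmbedding.comp (Homeomorph.neg ℝ).isEmbedding
  deriv_ne_zero s := by
    rw [deriv_comp_neg]
    exact neg_ne_zero.2 (h.deriv_ne_zero _)
  range_eq := by
    rw [← h.range_eq]
    exact (Equiv.neg ℝ).surjective.range_comp γ
  map_zero := by rw [neg_zero, h.map_zero]
  deriv_zero := by
    obtain ⟨c, hc, hderiv⟩ := h.deriv_zero
    exact ⟨c, hc, by rw [deriv_comp_neg, neg_zero, hderiv, smul_neg]⟩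

lemma MeetsOnceAt.of_neg {o : ℂ → ℂ} {k l : ℤ} {ζ ζ' p : ℂ} {ε : SignType}
    (h : MeetsOnceAt (fun z => -o z) k ζ l ζ' p ε) : MeetsOnceAt o k ζ l ζ' p ε := by
  obtain ⟨hinter, γ, δ, s, t, hγ, hδ, hs, ht, hdet⟩ := h
  refine ⟨hinter, fun s => γ (-s), fun s => δ (-s), -s, -t, by simpa using hγ.comp_neg,
    by simpa using hδ.comp_neg, by simpa, by simpa, ?_⟩
  simpa only [deriv_comp_neg, neg_neg, Complex.neg_re, Complex.neg_im, neg_mul_neg] using hdet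

/-! ### Crossings of two thimbles -/

lemma im_conj_mul (a b : ℂ) : (conj a * b).im = a.re * b.im - a.im * b.re := by
  rw [Complex.mul_im, Complex.conj_re, Complex.conj_im]; ring

lemma mul_ofReal_add_crit_eq_iff {ζ ζ' : ℂ} (hζ : (conj ζ * ζ').im ≠ 0) {a b : ℝ} {k l : ℤ} :
    ζ * a + crit k = ζ' * b + crit l ↔
      a * (conj ζ * ζ').im = 2 * π * (k - l) * ζ'.re ∧
        b * (conj ζ * ζ').im = 2 * π * (k - l) * ζ.re := by
  rw [im_conj_mul] at hζ ⊢
  simp only [Complex.ext_iff, Complex.add_re, Complex.add_im, Complex.re_mul_ofReal,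
    Complex.im_mul_ofReal, crit_re, crit_im]
  constructor
  · rintro ⟨hre, him⟩
    constructor
    · linear_combination ζ'.im * hre - ζ'.re * him
    · linear_combination ζ.im * hre - ζ.re * him
  · rintro ⟨ha, hb⟩
    constructor <;> refine mul_right_cancel₀ hζ ?_
    · linear_combination ζ.re * ha - ζ'.re * hb
    · linear_combination ζ.im * ha - ζ'.im * hb

/-- Parametrisations of two thimbles through `0` over the same half-plane, the second phase
being reached from the first one by a counterclockwise rotation of angle less than `π`. -/
structure IsThimbleCrossing (P : SheetPair) (ζ ζ' σ σ' : ℂ) (γ δ : ℝ → ℂ) : Prop where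
  fst : IsThimbleParam P ζ σ γ
  snd : IsThimbleParam P ζ' σ' δ
  im_pos : 0 < (conj ζ * ζ').im

namespace IsThimbleCrossing

variable {P : SheetPair} {ζ ζ' σ σ' : ℂ} {γ δ : ℝ → ℂ}

lemma W₀_eq_iff (h : IsThimbleCrossing P ζ ζ' σ σ' γ δ) {k l : ℤ} {s t : ℝ} :
    W₀ (γ s + crit k) = W₀ (δ t + crit l) ↔
      s ^ 2 * (conj ζ * ζ').im = 2 * π * (k - l) * ζ'.re ∧
        t ^ 2 * (conj ζ * ζ').im = 2 * π * (k - l) * ζ.re := by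
  rw [W₀_add_crit, W₀_add_crit, h.fst.W₀_eq, h.snd.W₀_eq, ← Complex.ofReal_pow,
    ← Complex.ofReal_pow, mul_ofReal_add_crit_eq_iff h.im_pos.ne']

lemma exists_pos_W₀_eq (h : IsThimbleCrossing P ζ ζ' σ σ' γ δ) {k l : ℤ}
    (hζ : 0 < (k - l) * ζ.re) (hζ' : 0 < (k - l) * ζ'.re) :
    ∃ s t : ℝ, 0 < s ∧ 0 < t ∧
      ∀ s' t' : ℝ, s' ^ 2 = s ^ 2 → t' ^ 2 = t ^ 2 → W₀ (γ s' + crit k) = W₀ (δ t' + crit l) := by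
  have hroot : ∀ x : ℝ, 0 < (k - l) * x →
      ∃ r > 0, r ^ 2 * (conj ζ * ζ').im = 2 * π * (k - l) * x := fun x hx => by
    have hpos : 0 < 2 * π * ((k - l) * x) / (conj ζ * ζ').im :=
      div_pos (mul_pos Real.two_pi_pos hx) h.im_pos
    refine ⟨_, Real.sqrt_pos.2 hpos, ?_⟩
    rw [Real.sq_sqrt hpos.le, div_mul_cancel₀ _ h.im_pos.ne', mul_assoc (2 * π)]
  obtain ⟨s, hs, hs2⟩ := hroot _ hζ'
  obtain ⟨t, ht, ht2⟩ := hroot _ hζ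
  exact ⟨s, t, hs, ht, fun s' t' hs' ht' => h.W₀_eq_iff.2 ⟨hs' ▸ hs2, ht' ▸ ht2⟩⟩

lemma mem_inter_iff (h : IsThimbleCrossing P ζ ζ' σ σ' γ δ) {k l : ℤ} {p : ℂ} :
    p ∈ L k ζ ∩ L l ζ' ↔ ∃ s t : ℝ, γ s + crit k = p ∧ δ t + crit l = p := by
  rw [← (h.fst.isOrientedParam k).range_eq, ← (h.snd.isOrientedParam l).range_eq]
  exact exists_and_exists_comm

lemma mul_re_nonneg_of_eq (h : IsThimbleCrossing P ζ ζ' σ σ' γ δ) {k l : ℤ} {s t : ℝ}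
    (hst : γ s + crit k = δ t + crit l) : 0 ≤ (k - l) * ζ.re := by
  have ht := (h.W₀_eq_iff.1 (congrArg W₀ hst)).2
  rw [mul_assoc (2 * π)] at ht
  exact nonneg_of_mul_nonneg_right (ht ▸ mul_nonneg (sq_nonneg t) h.im_pos.le) Real.two_pi_pos

lemma eq_zero_iff_of_eq (h : IsThimbleCrossing P ζ ζ' σ σ' γ δ) {k l : ℤ} {s t : ℝ}
    (hst : γ s + crit k = δ t + crit l) : s = 0 ↔ t = 0 := by
  rw [← h.fst.exp_eq_one_iff, ← h.snd.exp_eq_one_iff, ← exp_add_crit (γ s) k, hst, exp_add_crit]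

lemma eq_zero_of_eq (h : IsThimbleCrossing P ζ ζ' σ σ' γ δ) {k : ℤ} {s t : ℝ}
    (hst : γ s + crit k = δ t + crit k) : s = 0 := by
  have hs := (h.W₀_eq_iff.1 (congrArg W₀ hst)).1
  rwa [sub_self, mul_zero, zero_mul, mul_eq_zero_iff_right h.im_pos.ne', sq_eq_zero_iff] at hs

lemma ne_zero_of_eq (h : IsThimbleCrossing P ζ ζ' σ σ' γ δ) {k l : ℤ} (hkl : k ≠ l) {s t : ℝ}
    (hst : γ s + crit k = δ t + crit l) : s ≠ 0 ∧ t ≠ 0 := by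
  suffices hs : s ≠ 0 from ⟨hs, mt (h.eq_zero_iff_of_eq hst).2 hs⟩
  rintro rfl
  rw [(h.eq_zero_iff_of_eq hst).1 rfl, h.fst.map_zero, h.snd.map_zero, zero_add, zero_add] at hst
  have him := congrArg Complex.im hst
  rw [crit_im, crit_im, mul_right_inj' Real.two_pi_pos.ne'] at him
  exact hkl (by exact_mod_cast him)

lemma im_conj_dir_mul_pos (h : IsThimbleCrossing P ζ ζ' σ σ' γ δ) : 0 < (conj σ * σ').im := by
  have hsq : ∀ {z τ : ℂ} {α : ℝ → ℂ}, IsThimbleParam P z τ α → 0 < ((conj P.dir * τ) ^ 2).re :=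
    fun hα => by
      rw [mul_pow, hα.sq_eq_neg, mul_neg, ← neg_mul]
      exact hα.phase_mem
  have hre : 0 < (conj σ * σ').re := by
    refine pos_of_mul_pos_right (a := Complex.normSq P.dir) ?_ (Complex.normSq_nonneg _)
    have hmul : Complex.normSq P.dir * (conj σ * σ') =
        conj (conj P.dir * σ) * (conj P.dir * σ') := by
      rw [← Complex.mul_conj, map_mul, Complex.conj_conj]
      ring
    rw [← Complex.re_ofReal_mul, hmul]
    exact re_conj_mul_pos h.fst.re_pos h.snd.re_pos (hsq h.fst) (hsq h.snd)
  have him : 2 * (conj σ * σ').re * (conj σ * σ').im = (conj ζ * ζ').im := by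
    have hmul : (conj σ * σ') ^ 2 = conj ζ * ζ' := by
      rw [mul_pow, ← map_pow, h.fst.sq_eq_neg, h.snd.sq_eq_neg, map_neg, neg_mul_neg]
    rw [← hmul, sq, Complex.mul_im (conj σ * σ')]
    ring
  exact pos_of_mul_pos_right (him ▸ h.im_pos) (by positivity)

lemma sign_im_conj_deriv_mul (h : IsThimbleCrossing P ζ ζ' σ σ' γ δ) {k l : ℤ} {s t : ℝ}
    (hs : s ≠ 0) (hst : γ s + crit k = δ t + crit l) :
    SignType.sign (conj (deriv γ s) * deriv δ t).im = SignType.sign (s * t) := by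
  set w := 1 - Complex.exp (γ s) with hw
  have hγ : w * deriv γ s = ζ * (2 * s) := h.fst.exp_mul_deriv s
  have hδ : w * deriv δ t = ζ' * (2 * t) := by
    rw [hw, ← exp_add_crit _ k, hst, exp_add_crit, h.snd.exp_mul_deriv]
  have hw0 : 0 < Complex.normSq w :=
    Complex.normSq_pos.2 (sub_ne_zero.2 (Ne.symm (mt h.fst.exp_eq_one_iff.1 hs)))
  have hdet : Complex.normSq w * (conj (deriv γ s) * deriv δ t).im =
      4 * (conj ζ * ζ').im * (s * t) := by
    have hmul : Complex.normSq w * (conj (deriv γ s) * deriv δ t) =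
        conj ζ * ζ' * (4 * (s * t) : ℝ) := by
      rw [Complex.normSq_eq_conj_mul_self, mul_mul_mul_comm, ← map_mul, hγ, hδ]
      simp only [map_mul, Complex.conj_ofReal, map_ofNat, Complex.ofReal_mul,
        Complex.ofReal_ofNat]
      ring
    rw [← Complex.im_ofReal_mul, hmul, Complex.im_mul_ofReal]
    ring
  have hsign := congrArg SignType.sign hdet
  rwa [sign_mul, sign_mul, sign_pos hw0, sign_pos (mul_pos four_pos h.im_pos), one_mul,
    one_mul] at hsign

section MeetsOnceAt

variable {o : ℂ → ℂ}

lemma meetsOnceAt (h : IsThimbleCrossing P ζ ζ' (o ζ) (o ζ') γ δ) {k l : ℤ} {s t : ℝ}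
    {ε : SignType} (hst : γ s + crit k = δ t + crit l)
    (hunique : ∀ s' t', γ s' + crit k = δ t' + crit l → s' = s)
    (hsign : SignType.sign (conj (deriv γ s) * deriv δ t).im = ε) (hε : ε ≠ 0) :
    MeetsOnceAt o k ζ l ζ' (γ s + crit k) ε := by
  refine ⟨?_, fun s => γ s + crit k, fun t => δ t + crit l, s, t, h.fst.isOrientedParam k,
    h.snd.isOrientedParam l, rfl, hst.symm, ?_⟩
  · refine (subset_singleton_iff.2 fun p hp => ?_).antisymm
      (singleton_subset_iff.2 (h.mem_inter_iff.2 ⟨s, t, rfl, hst.symm⟩))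
    obtain ⟨s', t', rfl, hst'⟩ := h.mem_inter_iff.1 hp
    rw [hunique s' t' hst'.symm]
  · rw [deriv_add_const, deriv_add_const, ← im_conj_mul]
    exact ⟨sign_ne_zero.1 (hsign ▸ hε), hsign⟩

lemma meetsOnceAt_crit (h : IsThimbleCrossing P ζ ζ' (o ζ) (o ζ') γ δ) (k : ℤ) :
    MeetsOnceAt o k ζ k ζ' (crit k) 1 := by
  have hdet : 0 < (conj (deriv γ 0) * deriv δ 0).im := by
    rw [h.fst.hasDerivAt_zero.deriv, h.snd.hasDerivAt_zero.deriv, map_mul, Complex.conj_ofReal,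
      mul_mul_mul_comm, ← Complex.ofReal_mul, Complex.im_ofReal_mul]
    exact mul_pos (by positivity) h.im_conj_dir_mul_pos
  simpa only [h.fst.map_zero, zero_add] using h.meetsOnceAt (s := 0) (t := 0)
    (by rw [h.fst.map_zero, h.snd.map_zero]) (fun s' t' => h.eq_zero_of_eq) (sign_pos hdet)
    one_ne_zero

lemma meetsOnceAt_of_neg (h : IsThimbleCrossing P ζ ζ' (o ζ) (o ζ') γ δ) {k l : ℤ} (hkl : k ≠ l)
    {s t : ℝ} (hst : γ s + crit k = δ t + crit l)
    (hneg : ∀ s' t', γ s' + crit k = δ t' + crit l → s' < 0) :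
    MeetsOnceAt o k ζ l ζ' (γ s + crit k) (SignType.sign (s * t)) := by
  obtain ⟨hs, ht⟩ := h.ne_zero_of_eq hkl hst
  refine h.meetsOnceAt hst (fun s' t' hst' => ?_) (h.sign_im_conj_deriv_mul hs hst)
    (sign_ne_zero.2 (mul_ne_zero hs ht))
  have hsq : s' ^ 2 * (conj ζ * ζ').im = s ^ 2 * (conj ζ * ζ').im :=
    (h.W₀_eq_iff.1 (congrArg W₀ hst')).1.trans (h.W₀_eq_iff.1 (congrArg W₀ hst)).1.symm
  rw [mul_left_inj' h.im_pos.ne', sq_eq_sq_iff_eq_or_eq_neg] at hsq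
  exact hsq.resolve_right fun h0 => by linarith [hneg s t hst, hneg s' t' hst']

end MeetsOnceAt

end IsThimbleCrossing

lemma IsOrientation.exists_isThimbleCrossing {o : ℂ → ℂ} (ho : IsOrientation o) {P : SheetPair}
    (hP : ∀ z ∈ halfPlane P.dir, z.re ≠ 0) {ζ ζ' : ℂ} (hζ : ‖ζ‖ = 1) (hζP : ζ ∈ halfPlane P.dir)
    (hζ' : ‖ζ'‖ = 1) (hζP' : ζ' ∈ halfPlane P.dir) (him : 0 < (conj ζ * ζ').im) :
    ∃ (o' : ℂ → ℂ) (γ δ : ℝ → ℂ), IsThimbleCrossing P ζ ζ' (o' ζ) (o' ζ') γ δ ∧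
      ∀ k l p ε, MeetsOnceAt o' k ζ l ζ' p ε → MeetsOnceAt o k ζ l ζ' p ε := by
  have hexists : ∀ o' : ℂ → ℂ, IsOrientation o' →
      (∀ z ∈ Metric.sphere 0 1 ∩ halfPlane P.dir, 0 < (conj P.dir * o' z).re) →
      ∃ γ δ, IsThimbleCrossing P ζ ζ' (o' ζ) (o' ζ') γ δ := fun o' ho' hpos => by
    obtain ⟨γ, hγ⟩ := exists_isThimbleParam hζP (ho'.2 ζ hζ (hP ζ hζP))
      (hpos ζ ⟨mem_sphere_zero_iff_norm.2 hζ, hζP⟩)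
    obtain ⟨δ, hδ⟩ := exists_isThimbleParam hζP' (ho'.2 ζ' hζ' (hP ζ' hζP'))
      (hpos ζ' ⟨mem_sphere_zero_iff_norm.2 hζ', hζP'⟩)
    exact ⟨γ, δ, hγ, hδ, him⟩
  rcases ho.forall_re_pos_or_forall_re_neg hP with hpos | hneg
  · obtain ⟨γ, δ, h⟩ := hexists o ho hpos
    exact ⟨o, γ, δ, h, fun _ _ _ _ hmeet => hmeet⟩
  · obtain ⟨γ, δ, h⟩ := hexists (fun z => -o z) ho.neg fun z hz => by
      simpa only [mul_neg, Complex.neg_re, neg_pos] using hneg z hz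
    exact ⟨_, γ, δ, h, fun _ _ _ _ hmeet => hmeet.of_neg⟩

lemma add_crit_mem_leftSheet {Y : ℂ} (hY : Y ∈ leftSheet) (k : ℤ) : Y + crit k ∈ leftSheet := by
  simpa [leftSheet] using hY

lemma add_crit_mem_stripSheet {Y : ℂ} {m : ℤ} (hY : Y ∈ stripSheet m) (k : ℤ) :
    Y + crit k ∈ stripSheet (m + k) := by
  obtain ⟨⟨hlt, hgt⟩, hW⟩ := hY
  refine ⟨⟨?_, ?_⟩, by simpa using hW⟩ <;>
  · rw [Complex.add_im, crit_im]
    push_cast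
    linarith

lemma eq_of_abs_two_pi_mul_sub_lt {k l : ℤ} (h : |2 * π * k - 2 * π * l| < 2 * π) : k = l := by
  rw [← mul_sub, abs_mul, abs_of_pos Real.two_pi_pos,
    mul_lt_iff_lt_one_right Real.two_pi_pos] at h
  norm_cast at h
  exact sub_eq_zero.1 (Int.abs_lt_one_iff.1 h)

lemma eq_of_add_crit_eq_of_mem_rightSheet {Y Z : ℂ} (hY : Y ∈ rightSheet) (hZ : Z ∈ rightSheet)
    {k l : ℤ} (h : Y + crit k = Z + crit l) : k = l := by
  have him := congrArg Complex.im h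
  rw [Complex.add_im, Complex.add_im, crit_im, crit_im] at him
  obtain ⟨hY1, hY2⟩ : -(π / 2) < Y.im ∧ Y.im < π / 2 := abs_lt.1 hY.1.2
  obtain ⟨hZ1, hZ2⟩ : -(π / 2) < Z.im ∧ Z.im < π / 2 := abs_lt.1 hZ.1.2
  refine eq_of_abs_two_pi_mul_sub_lt (abs_lt.2 ?_)
  constructor <;> linarith [Real.pi_pos]

lemma eq_of_mem_stripSheet {Y : ℂ} {m n : ℤ} (hm : Y ∈ stripSheet m) (hn : Y ∈ stripSheet n) :
    m = n := by
  obtain ⟨hm1, hm2⟩ := hm.1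
  obtain ⟨hn1, hn2⟩ := hn.1
  exact eq_of_abs_two_pi_mul_sub_lt (abs_lt.2 ⟨by linarith, by linarith⟩)

section Intersections

variable {ζ ζ' σ σ' : ℂ} {γ δ : ℝ → ℂ} {k l : ℤ} {s t : ℝ}

lemma neg_of_add_crit_eq_leftPair (h : IsThimbleCrossing leftPair ζ ζ' σ σ' γ δ) (hkl : k ≠ l)
    (hst : γ s + crit k = δ t + crit l) : s < 0 := by
  obtain ⟨hs, ht⟩ := h.ne_zero_of_eq hkl hst
  refine hs.lt_of_le (not_lt.1 fun hs => ?_)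
  have hγ : γ s ∈ rightSheet := h.fst.mem_pos s hs
  rcases lt_or_gt_of_ne ht with ht | ht
  · have hδ : δ t ∈ leftSheet := h.snd.mem_neg t ht
    have hre : (γ s).re = (δ t).re := by simpa using congrArg Complex.re hst
    exact lt_asymm (show 0 < (γ s).re from hγ.1.1) (hre ▸ show (δ t).re < 0 from hδ.1)
  · exact hkl (eq_of_add_crit_eq_of_mem_rightSheet hγ (h.snd.mem_pos t ht) hst)

lemma neg_and_eq_of_add_crit_eq_rightPair (h : IsThimbleCrossing rightPair ζ ζ' σ σ' γ δ)
    (hkl : l < k) (hst : γ s + crit k = δ t + crit l) : s < 0 ∧ k = l + 1 := by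
  obtain ⟨hs, ht⟩ := h.ne_zero_of_eq hkl.ne' hst
  obtain ⟨n, hn, hδ⟩ : ∃ n ≤ l, δ t + crit l ∈ stripSheet n := by
    rcases lt_or_gt_of_ne ht with ht | ht
    · exact ⟨-1 + l, by lia, add_crit_mem_stripSheet (h.snd.mem_neg t ht) l⟩
    · exact ⟨0 + l, by lia, add_crit_mem_stripSheet (h.snd.mem_pos t ht) l⟩
  rw [← hst] at hδ
  rcases lt_or_gt_of_ne hs with hs | hs
  · have hstrip := eq_of_mem_stripSheet hδ (add_crit_mem_stripSheet (h.fst.mem_neg s hs) k)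
    exact ⟨hs, by lia⟩
  · have hstrip := eq_of_mem_stripSheet hδ (add_crit_mem_stripSheet (h.fst.mem_pos s hs) k)
    lia

variable {o : ℂ → ℂ}

lemma exists_meetsOnceAt_leftPair (h : IsThimbleCrossing leftPair ζ ζ' (o ζ) (o ζ') γ δ)
    (hkl : k < l) : ∃ p, MeetsOnceAt o k ζ l ζ' p 1 := by
  have hsub : (k - l : ℝ) < 0 := sub_neg.2 (Int.cast_lt.2 hkl)
  obtain ⟨s, t, hs, ht, hW⟩ := h.exists_pos_W₀_eq (k := k) (l := l)
    (mul_pos_of_neg_of_neg hsub (mem_halfPlane_one.1 h.fst.phase_mem))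
    (mul_pos_of_neg_of_neg hsub (mem_halfPlane_one.1 h.snd.phase_mem))
  have hst : γ (-s) + crit k = δ (-t) + crit l := isSheet_leftSheet.bijOn.injOn
    (add_crit_mem_leftSheet (h.fst.mem_neg _ (neg_neg_of_pos hs)) k)
    (add_crit_mem_leftSheet (h.snd.mem_neg _ (neg_neg_of_pos ht)) l) (hW _ _ (neg_sq s) (neg_sq t))
  have hmeet := h.meetsOnceAt_of_neg hkl.ne hst fun _ _ => neg_of_add_crit_eq_leftPair h hkl.ne
  rw [neg_mul_neg, sign_pos (mul_pos hs ht)] at hmeet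
  exact ⟨_, hmeet⟩

lemma exists_meetsOnceAt_rightPair (h : IsThimbleCrossing rightPair ζ ζ' (o ζ) (o ζ') γ δ)
    (l : ℤ) : ∃ p, MeetsOnceAt o (l + 1) ζ l ζ' p (-1) := by
  obtain ⟨s, t, hs, ht, hW⟩ := h.exists_pos_W₀_eq (k := l + 1) (l := l)
    (by simpa using mem_halfPlane_I.1 h.fst.phase_mem)
    (by simpa using mem_halfPlane_I.1 h.snd.phase_mem)
  have hγ : γ (-s) + crit (l + 1) ∈ stripSheet (-1 + (l + 1)) :=
    add_crit_mem_stripSheet (h.fst.mem_neg _ (neg_neg_of_pos hs)) (l + 1)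
  have hδ : δ t + crit l ∈ stripSheet (0 + l) :=
    add_crit_mem_stripSheet (h.snd.mem_pos _ ht) l
  rw [neg_add_cancel_comm_assoc] at hγ
  rw [zero_add] at hδ
  have hst : γ (-s) + crit (l + 1) = δ t + crit l :=
    injOn_stripSheet l hγ hδ (hW _ _ (neg_sq s) rfl)
  have hmeet := h.meetsOnceAt_of_neg (lt_add_one l).ne' hst fun _ _ hst' =>
    (neg_and_eq_of_add_crit_eq_rightPair h (lt_add_one l) hst').1
  rw [neg_mul, sign_neg (neg_neg_of_pos (mul_pos hs ht))] at hmeet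
  exact ⟨_, hmeet⟩

theorem inter_of_re_neg (ho : IsOrientation o) (hζ : ‖ζ‖ = 1) (hre : ζ.re < 0) (hζ' : ‖ζ'‖ = 1)
    (hre' : ζ'.re < 0) (him : 0 < (conj ζ * ζ').im) (k l : ℤ) :
    (k ≤ l → ∃ p, MeetsOnceAt o k ζ l ζ' p 1) ∧ (¬ k ≤ l → L k ζ ∩ L l ζ' = ∅) := by
  obtain ⟨o', γ, δ, h, hmeet⟩ := ho.exists_isThimbleCrossing (P := leftPair)
    (fun z hz => (mem_halfPlane_one.1 hz).ne) hζ (mem_halfPlane_one.2 hre) hζ'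
    (mem_halfPlane_one.2 hre') him
  refine ⟨fun hkl => ?_, fun hkl => eq_empty_iff_forall_notMem.2 fun p hp => ?_⟩
  · rcases hkl.eq_or_lt with rfl | hkl
    · exact ⟨_, hmeet _ _ _ _ (h.meetsOnceAt_crit k)⟩
    · exact (exists_meetsOnceAt_leftPair h hkl).imp fun p => hmeet _ _ _ _
  · obtain ⟨s, t, rfl, hst⟩ := h.mem_inter_iff.1 hp
    have hsub : (0 : ℝ) < k - l := sub_pos.2 (Int.cast_lt.2 (not_le.1 hkl))
    exact (mul_neg_of_pos_of_neg hsub hre).not_ge (h.mul_re_nonneg_of_eq hst.symm)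

theorem inter_of_re_pos (ho : IsOrientation o) (hζ : ‖ζ‖ = 1) (hre : 0 < ζ.re) (hζ' : ‖ζ'‖ = 1)
    (hre' : 0 < ζ'.re) (him : 0 < (conj ζ * ζ').im) (k l : ℤ) :
    (k = l + 1 → ∃ p, MeetsOnceAt o k ζ l ζ' p (-1)) ∧
    (k = l → ∃ p, MeetsOnceAt o k ζ l ζ' p 1) ∧
    (k ≠ l → k ≠ l + 1 → L k ζ ∩ L l ζ' = ∅) := by
  obtain ⟨o', γ, δ, h, hmeet⟩ := ho.exists_isThimbleCrossing (P := rightPair)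
    (fun z hz => (mem_halfPlane_I.1 hz).ne') hζ (mem_halfPlane_I.2 hre) hζ'
    (mem_halfPlane_I.2 hre') him
  refine ⟨?_, ?_, fun hkl hkl' => eq_empty_iff_forall_notMem.2 fun p hp => hkl' ?_⟩
  · rintro rfl
    exact (exists_meetsOnceAt_rightPair h l).imp fun p => hmeet _ _ _ _
  · rintro rfl
    exact ⟨_, hmeet _ _ _ _ (h.meetsOnceAt_crit k)⟩
  · obtain ⟨s, t, rfl, hst⟩ := h.mem_inter_iff.1 hp
    have hle : (0 : ℝ) ≤ k - l := nonneg_of_mul_nonneg_left (h.mul_re_nonneg_of_eq hst.symm) hre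
    have hlt : l < k := lt_of_le_of_ne (Int.cast_le.1 (sub_nonneg.1 hle)) hkl.symm
    exact (neg_and_eq_of_add_crit_eq_rightPair h hlt hst.symm).2

end Intersections

lemma im_conj_exp_mul_exp (a b : ℝ) :
    (conj (Complex.exp (-(a * Complex.I))) * Complex.exp (b * Complex.I)).im =
      Real.sin (a + b) := by
  rw [← Complex.exp_conj, ← Complex.exp_add, ← Complex.exp_ofReal_mul_I_im]
  simp [add_mul]

end Thimble

open scoped ComplexConjugate in
theorem lemma4p2_general (θ θ' : ℝ) (hθ : θ ∈ Set.Ioo (-(Real.pi / 2)) (Real.pi / 2))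
    (hθ' : θ' ∈ Set.Ioo (-(Real.pi / 2)) (Real.pi / 2)) (hsum : 0 < θ' + θ) (o : ℂ → ℂ)
    (ho : Thimble.IsOrientation o) (k l : ℤ) :
    (k ≤ l → ∃ p : ℂ, Thimble.MeetsOnceAt o k (-Complex.exp (-(θ' * Complex.I)))
        l (-Complex.exp (θ * Complex.I)) p 1) ∧
    (¬ k ≤ l → Thimble.L k (-Complex.exp (-(θ' * Complex.I))) ∩
        Thimble.L l (-Complex.exp (θ * Complex.I)) = ∅) ∧
    (k = l + 1 → ∃ p : ℂ, Thimble.MeetsOnceAt o k (Complex.exp (-(θ' * Complex.I)))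
        l (Complex.exp (θ * Complex.I)) p (-1)) ∧
    (k = l → ∃ p : ℂ, Thimble.MeetsOnceAt o k (Complex.exp (-(θ' * Complex.I)))
        l (Complex.exp (θ * Complex.I)) p 1) ∧
    (k ≠ l → k ≠ l + 1 → Thimble.L k (Complex.exp (-(θ' * Complex.I))) ∩
        Thimble.L l (Complex.exp (θ * Complex.I)) = ∅) := by
  have hnorm : ‖Complex.exp (θ * Complex.I)‖ = 1 := Complex.norm_exp_ofReal_mul_I θ
  have hnorm' : ‖Complex.exp (-(θ' * Complex.I))‖ = 1 := by simp [Complex.norm_exp]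
  have hre : 0 < (Complex.exp (θ * Complex.I)).re := by
    rw [Complex.exp_ofReal_mul_I_re]
    exact Real.cos_pos_of_mem_Ioo hθ
  have hre' : 0 < (Complex.exp (-(θ' * Complex.I))).re := by
    simpa [Complex.exp_re] using Real.cos_pos_of_mem_Ioo hθ'
  have him : 0 < (conj (Complex.exp (-(θ' * Complex.I))) * Complex.exp (θ * Complex.I)).im := by
    rw [Thimble.im_conj_exp_mul_exp]
    exact Real.sin_pos_of_pos_of_lt_pi hsum (by linarith [hθ.2, hθ'.2])
  obtain ⟨hI, hI_empty⟩ := Thimble.inter_of_re_neg ho (norm_neg _ |>.trans hnorm')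
    (neg_neg_of_pos hre') (norm_neg _ |>.trans hnorm) (neg_neg_of_pos hre)
    (by rwa [map_neg, neg_mul_neg]) k l
  exact ⟨hI, hI_empty, Thimble.inter_of_re_pos ho hnorm' hre' hnorm hre him k l⟩

theorem lemma4p2 (θ θ' : ℝ) (hθ : θ ∈ Set.Ioo 0 (Real.pi / 2))
    (hθ' : θ' ∈ Set.Ioo 0 (Real.pi / 2)) (o : ℂ → ℂ) (ho : Thimble.IsOrientation o) (k l : ℤ) :
    -- the intersections `I_{k,l}`
    (k ≤ l → ∃ p : ℂ, Thimble.MeetsOnceAt o k (-Complex.exp (-(θ' * Complex.I)))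
        l (-Complex.exp (θ * Complex.I)) p 1) ∧
    (¬ k ≤ l → Thimble.L k (-Complex.exp (-(θ' * Complex.I))) ∩
        Thimble.L l (-Complex.exp (θ * Complex.I)) = ∅) ∧
    -- the intersections `J_{k,l}`
    (k = l + 1 → ∃ p : ℂ, Thimble.MeetsOnceAt o k (Complex.exp (-(θ' * Complex.I)))
        l (Complex.exp (θ * Complex.I)) p (-1)) ∧
    (k = l → ∃ p : ℂ, Thimble.MeetsOnceAt o k (Complex.exp (-(θ' * Complex.I)))
        l (Complex.exp (θ * Complex.I)) p 1) ∧
    (k ≠ l → k ≠ l + 1 → Thimble.L k (Complex.exp (-(θ' * Complex.I))) ∩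
        Thimble.L l (Complex.exp (θ * Complex.I)) = ∅) :=
  lemma4p2_general θ θ' ⟨by linarith [hθ.1, hθ.2], hθ.2⟩ ⟨by linarith [hθ'.1, hθ'.2], hθ'.2⟩
    (add_pos hθ'.1 hθ.1) o ho k l
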